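/- Let $n\ge 1$ and let $\mathcal{A}$ be a coefficient-free cluster algebra of type $A_n$. That is, $\mathcal{A}$ is given by a cluster pattern with trivial coefficients $t\mapsto(\mathbf{x}_t,B_t)$, $\mathbf{x}_t=(x_{1;t},\dots,x_{n;t})$, assigning a labeled seed to each vertex $t$ of the $n$-regular tree $\mathbb{T}_n$ (seeds joined by an edge labelled $k$ being related by the mutation $\mu_k$), and, for some vertex $t$, the Cartan counterpart of the exchange matrix $B_t=(b_{ij})$ (the matrix with diagonal entries $2$ and off-diagonal entries $-|b_{ij}|$) is, up to a simultaneous permutation of rows and columns, the Cartan matrix of type $A_n$. Fix any vertex $t_0\in\mathbb{T}_n$ and let $\mathbf{x}=(x_1,\dots,x_n)=\mathbf{x}_{t_0}$ be the initial cluster. Then, for every $t\in\mathbb{T}_n$ and $i\in\{1,\dots,n\}$, the cluster variable $x_{i;t}$ can be written in exactly one way as $$x_{i;t}=\frac{N_{i;t}(x_1,\dots,x_n)}{x_1^{d_{1i;t}}\cdots x_n^{d_{ni;t}}},$$ where $d_{1i;t},\dots,d_{ni;t}\in\mathbb{Z}$ and $N_{i;t}$ is a polynomial with integer coefficients that is not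 divisible by any of the variables $x_1,\dots,x_n$; and every coefficient of $N_{i;t}$ is $0$, $1$ or $2$. -/

import Mathlib

/-! Coefficient-free cluster algebras, following Fomin and Zelevinsky. -/

namespace ClusterA

/-- The vertices of the `n`-regular tree `𝕋_n` whose edges are labelled by `Fin n` so that the
`n` edges at each vertex carry different labels: words in the labels without two equal
consecutive letters. The word `k₁ k₂ ⋯ kᵣ` is the vertex reached from the empty word along the
edges labelled `kᵣ, …, k₂, k₁` in this order. -/
def RegularTree (n : ℕ) : Type :=
  {w : List (Fin n) // w.IsChain (fun a b => a ≠ b)}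

/-- `Edge k t t'`: the vertices `t` and `t'` of `𝕋_n` are joined by an edge labelled `k`. -/
def Edge {n : ℕ} (k : Fin n) (t t' : RegularTree n) : Prop :=
  t'.1 = k :: t.1 ∨ t.1 = k :: t'.1

/-- Each vertex of `𝕋_n` has exactly one neighbour along an edge labelled `k`. -/
theorem existsUnique_edge {n : ℕ} (k : Fin n) (t : RegularTree n) : ∃! t', Edge k t t' := by
  obtain ⟨w, hw⟩ := t
  by_cases h : (k :: w).IsChain (fun a b => a ≠ b)
  · refine ⟨⟨k :: w, h⟩, Or.inl rfl, ?_⟩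
    rintro ⟨w', hw'⟩ (h1 | h1)
    · exact Subtype.ext h1
    · simp only at h1
      subst h1
      simp at h
  · match w, hw, h with
    | [], _, h => simp at h
    | a :: w, hw, h =>
      have hk : k = a := by
        by_contra hne
        exact h (List.isChain_cons_cons.2 ⟨hne, hw⟩)
      subst hk
      refine ⟨⟨w, hw.tail⟩, Or.inr rfl, ?_⟩
      rintro ⟨w', hw'⟩ (h1 | h1)
      · simp only at h1
        subst h1
        exact absurd hw' h
      · simp only [List.cons.injEq, true_and] at h1
        exact Subtype.ext h1.symm

/-- An integer square matrix `B` is skew-symmetrizable if `D * B` is skew-symmetric for some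
diagonal matrix `D` with positive integer diagonal entries. -/
def IsSkewSymmetrizable {n : ℕ} (B : Matrix (Fin n) (Fin n) ℤ) : Prop :=
  ∃ d : Fin n → ℤ, (∀ i, 0 < d i) ∧
    (Matrix.diagonal d * B).transpose = -(Matrix.diagonal d * B)

/-- The data `(x, B)` of a labeled seed with trivial coefficients in the field `F`. -/
@[ext]
structure SeedData (n : ℕ) (F : Type*) where
  /-- the cluster -/
  x : Fin n → F
  /-- the exchange matrix -/
  B : Matrix (Fin n) (Fin n) ℤ

/-- `(x, B)` is a labeled seed in `F`: the entries of `x` are algebraically independent over `ℚ`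
and generate the field `F` over `ℚ` (so that `F` is a field of rational functions over `ℚ` in `n`
indeterminates), and `B` is skew-symmetrizable. -/
structure SeedData.IsSeed {n : ℕ} {F : Type*} [Field F] [CharZero F] (S : SeedData n F) :
    Prop where
  algebraicIndependent : AlgebraicIndependent ℚ S.x
  adjoin_eq_top : IntermediateField.adjoin ℚ (Set.range S.x) = ⊤
  skewSymmetrizable : IsSkewSymmetrizable S.B

/-- The mutation `μ_k` of exchange matrices, where `max a 0` is `[a]₊`. -/
def mutateMatrix {n : ℕ} (k : Fin n) (B : Matrix (Fin n) (Fin n) ℤ) :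
    Matrix (Fin n) (Fin n) ℤ :=
  Matrix.of fun i j =>
    if i = k ∨ j = k then -B i j
    else B i j + max (B i k) 0 * B k j + B i k * max (-B k j) 0

/-- The mutation `μ_k` of seeds with trivial coefficients; the exponent `a.toNat` is `[a]₊`. -/
noncomputable def SeedData.mutate {n : ℕ} {F : Type*} [Field F] (k : Fin n) (S : SeedData n F) :
    SeedData n F where
  x := fun i =>
    if i = k then
      (S.x k)⁻¹ * (∏ j, S.x j ^ (S.B j k).toNat + ∏ j, S.x j ^ (-S.B j k).toNat)
    else S.x i
  B := mutateMatrix k S.B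

/-- A cluster pattern of rank `n` with trivial coefficients in `F`: a labeled seed at each vertex
of `𝕋_n`, such that the seeds at the two ends of an edge labelled `k` are related by `μ_k`. -/
structure ClusterPattern (n : ℕ) (F : Type*) [Field F] [CharZero F] where
  seed : RegularTree n → SeedData n F
  isSeed : ∀ t, (seed t).IsSeed
  seed_eq_mutate : ∀ (k : Fin n) (t t' : RegularTree n), Edge k t t' →
    seed t' = (seed t).mutate k

/-- The Cartan counterpart of a square integer matrix. -/
def cartanCounterpart {n : ℕ} (B : Matrix (Fin n) (Fin n) ℤ) : Matrix (Fin n) (Fin n) ℤ :=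
  Matrix.of fun i j => if i = j then 2 else -|B i j|

/-- The cluster algebra of the pattern is of type `A_n`: up to a simultaneous permutation of rows
and columns, the Cartan counterpart of one of its exchange matrices is the Cartan matrix
of type `A_n`. -/
def ClusterPattern.IsTypeA {n : ℕ} {F : Type*} [Field F] [CharZero F]
    (P : ClusterPattern n F) : Prop :=
  ∃ (t : RegularTree n) (σ : Equiv.Perm (Fin n)),
    (cartanCounterpart (P.seed t).B).submatrix σ σ = CartanMatrix.A n

/-- `y = N(x₁, …, xₙ) / (x₁ ^ d₁ ⋯ xₙ ^ dₙ)`, where `N` is an integer polynomial which is not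
divisible by any of the variables and the `dⱼ` are integers. -/
def IsReducedLaurentExpr {n : ℕ} {F : Type*} [Field F] (x : Fin n → F) (y : F)
    (N : MvPolynomial (Fin n) ℤ) (d : Fin n → ℤ) : Prop :=
  (∀ j, ¬ MvPolynomial.X j ∣ N) ∧ y = MvPolynomial.aeval x N / ∏ j, x j ^ d j

end ClusterA

/-! The seeds of type A are modelled by triangulations of a polygon with `n + 3` vertices. A single
function `l` on pairs of vertices, equal to `1` on the sides and satisfying the Ptolemy relations,
gives every cluster variable as the value of a chord. Exchange matrices are signed adjacency
matrices, mutations are flips, and the exchange relation is a Ptolemy relation (`Realizes.mutate`).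
To start, some seed of the pattern has a linearly oriented path as its quiver, and a fan of
diagonals realizes it (`realizes_fan`).

Fix the triangulation at `t₀`. Moving from `p` to `q` through the triangles and applying one Ptolemy
relation per triangle writes `l p q` as a Laurent monomial times a sum of distinct squarefree
monomials in the variables `ŷ k`, because each diagonal is passed only once
(`Realizes.expands_of_crossing`). So the only source of coefficients above `1` is the coincidence,
after substitution of the `ŷ k`, of the exponents attached to different index sets `e`; these
exponents are a constant vector plus `B` applied to the indicator vector of `e`.

Index sets with the same exponent have indicator vectors that differ by elements of the kernel of
`B`. This kernel has rank at most one, by a direct check for a path and by invariance under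
mutation. The indicator vectors therefore lie on a line, which meets the vertices of a cube in at
most two points (`KernelRankLEOne.card_fibre_le`). No cancellation occurs, so removing the common
monomial leaves a numerator with coefficients at most `2`. -/

namespace ClusterA

open Finset

/-! ### Chords and triangulations of a polygon -/

/-- `a`, `b`, `c` are distinct and occur in this cyclic order. -/
def Cyc (a b c : ℕ) : Prop :=
  a < b ∧ b < c ∨ b < c ∧ c < a ∨ c < a ∧ a < b

/-- The chords `ab` and `pq` cross in their interiors. -/
def Cross (a b p q : ℕ) : Prop :=
  Cyc a p b ∧ Cyc b q a ∨ Cyc a q b ∧ Cyc b p a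

/-- `ab` is a side of the polygon with vertices `0, …, n + 2`. -/
def Side (n a b : ℕ) : Prop :=
  a < n + 3 ∧ b < n + 3 ∧ (b = a + 1 ∨ a = b + 1 ∨ a = 0 ∧ b = n + 2 ∨ b = 0 ∧ a = n + 2)

/-- `ab` is a side of the polygon or one of the diagonals `D i`. -/
def IsEdge {n : ℕ} (D : Fin n → Sym2 ℕ) (a b : ℕ) : Prop :=
  Side n a b ∨ ∃ i, D i = s(a, b)

/-- The `D i` are distinct diagonals of the polygon with vertices `0, …, n + 2` and form a maximal
set of pairwise noncrossing diagonals. -/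
structure IsTriangulation {n : ℕ} (D : Fin n → Sym2 ℕ) : Prop where
  injective : Function.Injective D
  lt : ∀ {i a b}, D i = s(a, b) → a < n + 3
  not_side : ∀ {i a b}, D i = s(a, b) → a ≠ b ∧ ¬ Side n a b
  not_cross : ∀ {i j a b p q}, D i = s(a, b) → D j = s(p, q) → ¬ Cross a b p q
  maximal : ∀ {p q}, p < n + 3 → q < n + 3 → p ≠ q →
    (∀ i a b, D i = s(a, b) → ¬ Cross a b p q) → IsEdge D p q

theorem Side.symm {n a b : ℕ} (h : Side n a b) : Side n b a := by
  unfold Side at *; omega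

theorem Side.not_cross {n a b p q : ℕ} (h : Side n a b) (hp : p < n + 3) (hq : q < n + 3) :
    ¬ Cross a b p q := by
  unfold Side at h; unfold Cross Cyc; omega

theorem Cross.symm {a b p q : ℕ} (h : Cross a b p q) : Cross p q a b := by
  unfold Cross Cyc at *; omega

theorem Cyc.rotate {a b c : ℕ} (h : Cyc a b c) : Cyc b c a := by
  unfold Cyc at *; omega

section Edge

variable {n : ℕ} {D : Fin n → Sym2 ℕ}

theorem IsEdge.symm {a b : ℕ} (h : IsEdge D a b) : IsEdge D b a := by
  rcases h with h | ⟨i, hi⟩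
  · exact Or.inl h.symm
  · exact Or.inr ⟨i, hi.trans Sym2.eq_swap⟩

namespace IsTriangulation

theorem lt' (hD : IsTriangulation D) {i : Fin n} {a b : ℕ} (h : D i = s(a, b)) : b < n + 3 :=
  hD.lt (h.trans Sym2.eq_swap)

theorem edge_lt (hD : IsTriangulation D) {a b : ℕ} (h : IsEdge D a b) : a < n + 3 ∧ b < n + 3 := by
  rcases h with h | ⟨i, hi⟩
  · exact ⟨h.1, h.2.1⟩
  · exact ⟨hD.lt hi, hD.lt' hi⟩

theorem edge_not_cross (hD : IsTriangulation D) {a b p q : ℕ} (h : IsEdge D a b)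
    (h' : IsEdge D p q) :
    ¬ Cross a b p q := by
  have hp := hD.edge_lt h'
  have ha := hD.edge_lt h
  rcases h with h | ⟨i, hi⟩
  · exact h.not_cross hp.1 hp.2
  rcases h' with h' | ⟨j, hj⟩
  · exact fun hc => h'.not_cross ha.1 ha.2 hc.symm
  · exact hD.not_cross hi hj

/-- An edge with a vertex on its left is the base of a triangle on its left. -/
theorem exists_apex (hD : IsTriangulation D) {a b z : ℕ} (h : IsEdge D a b)
    (hz : Cyc a z b) (hzn : z < n + 3) :
    ∃ c, Cyc a c b ∧ IsEdge D a c ∧ IsEdge D c b := by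
  have hab := hD.edge_lt h
  obtain ⟨s, hs, hsc⟩ : ∃ s, Side n a s ∧ Cyc a s b := by
    by_cases h' : a + 1 < n + 3
    · exact ⟨a + 1, by unfold Side; omega, by unfold Cyc at *; omega⟩
    · exact ⟨0, by unfold Side; omega, by unfold Cyc at *; omega⟩
  classical
  -- The apex is the neighbour of `a` furthest along the arc towards `b`; the side leaving `a`
  -- ensures that there is a candidate.
  let len : ℕ → ℕ := fun c => if a < c then c - a else c + (n + 3) - a
  obtain ⟨c, hc, hmax⟩ := Finset.exists_max_image
    {c ∈ Finset.range (n + 3) | Cyc a c b ∧ IsEdge D a c} len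
    ⟨s, by simp only [Finset.mem_filter, Finset.mem_range]; exact ⟨hs.2.1, hsc, Or.inl hs⟩⟩
  simp only [Finset.mem_filter, Finset.mem_range] at hc hmax
  obtain ⟨hcn, hacb, hac⟩ := hc
  refine ⟨c, hacb, hac, hD.maximal hcn hab.2 (by unfold Cyc at hacb; omega) ?_⟩
  have key : ∀ u v, IsEdge D u v → Cyc c u b → Cyc b v c → False := by
    intro u v huv hu hv
    have h1 := hD.edge_not_cross h huv
    have h2 := hD.edge_not_cross hac huv
    -- An edge that separates `c` from `b` must end at `a`, as otherwise it crosses `ab` or `ac`.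
    -- Its other end is then a neighbour of `a` beyond `c`.
    have hva : v = a := by
      have hv' : v = a ∨ Cyc b v a ∨ Cyc a v c := by
        clear hz hsc hmax h1 h2; unfold Cyc at *; omega
      rcases hv' with hv' | hv' | hv'
      · exact hv'
      · exact absurd (Or.inl ⟨by clear hz hsc hmax h1 h2; unfold Cyc at *; omega, hv'⟩) h1
      · exact absurd (Or.inr ⟨hv', by clear hz hsc hmax h1 h2; unfold Cyc at *; omega⟩) h2
    subst hva
    have hlt := hD.edge_lt huv
    have := hmax u ⟨hlt.1, by clear hz hsc hmax h1 h2; unfold Cyc at *; omega, huv.symm⟩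
    simp only [len] at this
    clear hz hsc hmax h1 h2
    unfold Cyc at *
    split_ifs at this <;> omega
  intro i u v hi hx
  rcases hx.symm with ⟨h1, h2⟩ | ⟨h1, h2⟩
  · exact key u v (Or.inr ⟨i, hi⟩) h1 h2
  · exact key v u (IsEdge.symm (Or.inr ⟨i, hi⟩)) h1 h2

/-- Of two different apexes over the same base, each would send an edge to one end of the base, and
two of these edges would cross. -/
theorem apex_unique (hD : IsTriangulation D) {a b c c' : ℕ} (h : Cyc a c b) (hac : IsEdge D a c)
    (hcb : IsEdge D c b) (h' : Cyc a c' b) (hac' : IsEdge D a c') (hcb' : IsEdge D c' b) :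
    c = c' := by
  have h3 : c = c' ∨ Cyc a c' c ∨ Cyc c c' b := by unfold Cyc at *; omega
  rcases h3 with h3 | h3 | h3
  · exact h3
  · exact absurd (Or.inl ⟨h3, by unfold Cyc at *; omega⟩) (hD.edge_not_cross hac hcb')
  · exact (hD.edge_not_cross hcb hac' (Or.inr ⟨h3, by unfold Cyc at *; omega⟩)).elim

/-- Every diagonal has triangles on both sides. -/
theorem exists_quadrilateral (hD : IsTriangulation D) {i : Fin n} {a b : ℕ} (h : D i = s(a, b)) :
    ∃ c d, Cyc a c b ∧ Cyc b d a ∧ IsEdge D a c ∧ IsEdge D c b ∧ IsEdge D b d ∧ IsEdge D d a := by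
  have hs := hD.not_side h
  have ha := hD.lt h
  have hb := hD.lt' h
  have hab : IsEdge D a b := Or.inr ⟨i, h⟩
  have aux : ∀ u v, u ≠ v → ¬ Side n u v → u < n + 3 → v < n + 3 →
      ∃ z, Cyc u z v ∧ z < n + 3 := by
    intro u v h1 h2 h3 h4
    by_cases h5 : u + 1 < n + 3
    · exact ⟨u + 1, by unfold Side at h2; unfold Cyc; omega, by omega⟩
    · exact ⟨0, by unfold Side at h2; unfold Cyc; omega, by omega⟩
  obtain ⟨z, hz, hz'⟩ := aux a b hs.1 hs.2 ha hb
  obtain ⟨w, hw, hw'⟩ := aux b a hs.1.symm (fun h => hs.2 h.symm) hb ha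
  obtain ⟨c, h1, h2, h3⟩ := hD.exists_apex hab hz hz'
  obtain ⟨d, h4, h5, h6⟩ := hD.exists_apex hab.symm hw hw'
  exact ⟨c, d, h1, h4, h2, h3, h5, h6⟩

end IsTriangulation

/-- A chord crossing neither the sides of a quadrilateral nor its diagonal `ab`, but crossing its
other diagonal, is `ab`; and similarly for the two diagonals exchanged. -/
theorem eq_of_cross_diagonal {a b c d p q : ℕ} (hc : Cyc a c b) (hd : Cyc b d a)
    (h : Cross c d p q) (h1 : ¬ Cross a c p q) (h2 : ¬ Cross c b p q) (h3 : ¬ Cross b d p q)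
    (h4 : ¬ Cross d a p q) : s(p, q) = s(a, b) := by
  rw [Sym2.eq_iff]
  have key : ∀ p q, Cyc c p d → Cyc d q c → ¬ Cross a c p q → ¬ Cross c b p q →
      ¬ Cross b d p q → ¬ Cross d a p q → p = b ∧ q = a := by
    clear h h1 h2 h3 h4
    intro p q hp hq h1 h2 h3 h4
    -- An endpoint strictly between two consecutive corners is cut off by a side of the
    -- quadrilateral, and the chord would cross that side.
    have hp' : p = b ∨ Cyc c p b ∨ Cyc b p d := by unfold Cyc at *; omega
    have hq' : q = a ∨ Cyc d q a ∨ Cyc a q c := by unfold Cyc at *; omega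
    rcases hp' with hp' | hp' | hp'
    · refine ⟨hp', ?_⟩
      subst hp'
      rcases hq' with hq' | hq' | hq'
      · exact hq'
      · exact absurd (Or.inr ⟨hq', by unfold Cyc at *; omega⟩) h4
      · exact absurd (Or.inr ⟨hq', by unfold Cyc at *; omega⟩) h1
    · exact absurd (Or.inl ⟨hp', by unfold Cyc at *; omega⟩) h2
    · exact absurd (Or.inl ⟨hp', by unfold Cyc at *; omega⟩) h3
  rcases h with ⟨h5, h6⟩ | ⟨h5, h6⟩
  · have := key p q h5 h6 h1 h2 h3 h4
    omega
  · have hs : ∀ {u v p q}, ¬ Cross u v p q → ¬ Cross u v q p := by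
      intro u v p q h h'
      exact h (h'.elim (fun h => Or.inr h) (fun h => Or.inl h))
    have := key q p h5 h6 (hs h1) (hs h2) (hs h3) (hs h4)
    omega

/-- Flipping a diagonal in its quadrilateral gives a triangulation. -/
theorem IsTriangulation.flip (hD : IsTriangulation D) {k : Fin n} {a b c d : ℕ}
    (hk : D k = s(a, b)) (hc : Cyc a c b) (hd : Cyc b d a) (hac : IsEdge D a c)
    (hcb : IsEdge D c b) (hbd : IsEdge D b d) (hda : IsEdge D d a) :
    IsTriangulation (Function.update D k s(c, d)) := by
  have hcd : Cross a b c d := Or.inl ⟨hc, hd⟩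
  have hdc : Cross a b d c := Or.inr ⟨hc, hd⟩
  have hlc := (hD.edge_lt hac).2
  have hld := (hD.edge_lt hda).1
  have hla := (hD.edge_lt hda).2
  have hlb := (hD.edge_lt hbd).1
  have hne : c ≠ d := by unfold Cyc at *; omega
  have hns : ¬ Side n c d := fun h => h.not_cross hla hlb hcd.symm
  have hold : ∀ j, j ≠ k → D j ≠ s(c, d) := fun j _ h => hD.not_cross hk h hcd
  have hncr : ∀ j p q, j ≠ k → D j = s(p, q) → ¬ Cross c d p q := by
    intro j p q hj hjp hx
    have he : IsEdge D p q := Or.inr ⟨j, hjp⟩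
    have := eq_of_cross_diagonal hc hd hx (hD.edge_not_cross hac he) (hD.edge_not_cross hcb he)
      (hD.edge_not_cross hbd he) (hD.edge_not_cross hda he)
    exact hj (hD.injective (hjp.trans (this.trans hk.symm)))
  have hcross_swap : ∀ {u v p q}, Cross u v p q → Cross v u p q := by
    intro u v p q h
    unfold Cross at *; tauto
  have hupd : ∀ {i u v}, Function.update D k s(c, d) i = s(u, v) →
      (i = k ∧ (c = u ∧ d = v ∨ c = v ∧ d = u)) ∨ (i ≠ k ∧ D i = s(u, v)) := by
    intro i u v h
    by_cases hik : i = k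
    · subst hik
      rw [Function.update_self] at h
      exact Or.inl ⟨rfl, Sym2.eq_iff.1 h⟩
    · rw [Function.update_of_ne hik] at h
      exact Or.inr ⟨hik, h⟩
  constructor
  · intro i j hij
    by_cases hi : i = k <;> by_cases hj : j = k
    · rw [hi, hj]
    · subst hi
      rw [Function.update_self, Function.update_of_ne hj] at hij
      exact absurd hij.symm (hold j hj)
    · subst hj
      rw [Function.update_self, Function.update_of_ne hi] at hij
      exact absurd hij (hold i hi)
    · rw [Function.update_of_ne hi, Function.update_of_ne hj] at hij
      exact hD.injective hij
  · intro i u v h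
    rcases hupd h with ⟨-, ⟨rfl, rfl⟩ | ⟨rfl, rfl⟩⟩ | ⟨-, h⟩
    · exact hlc
    · exact hld
    · exact hD.lt h
  · intro i u v h
    rcases hupd h with ⟨-, ⟨rfl, rfl⟩ | ⟨rfl, rfl⟩⟩ | ⟨-, h⟩
    · exact ⟨hne, hns⟩
    · exact ⟨hne.symm, fun h => hns h.symm⟩
    · exact hD.not_side h
  · intro i j u v p q hi hj hx
    rcases hupd hi with ⟨h1, hi⟩ | ⟨h1, hi⟩ <;> rcases hupd hj with ⟨h2, hj⟩ | ⟨h2, hj⟩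
    · unfold Cross Cyc at *; omega
    · rcases hi with ⟨rfl, rfl⟩ | ⟨rfl, rfl⟩
      · exact hncr j p q h2 hj hx
      · exact hncr j p q h2 hj (hcross_swap hx)
    · rcases hj with ⟨rfl, rfl⟩ | ⟨rfl, rfl⟩
      · exact hncr i u v h1 hi hx.symm
      · exact hncr i u v h1 hi (hcross_swap hx.symm)
    · exact hD.not_cross hi hj hx
  · intro p q hp hq hpq h
    have hedge : IsEdge D p q → s(p, q) ≠ D k →
        IsEdge (Function.update D k s(c, d)) p q := by
      rintro (h | ⟨i, hi⟩) h'
      · exact Or.inl h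
      · refine Or.inr ⟨i, ?_⟩
        rw [Function.update_of_ne, hi]
        rintro rfl
        exact h' hi.symm
    have hcdpq : ¬ Cross c d p q := h k c d (Function.update_self ..)
    have hother : ∀ i u v, i ≠ k → D i = s(u, v) → ¬ Cross u v p q := by
      intro i u v hik hi
      exact h i u v (by rw [Function.update_of_ne hik, hi])
    -- A chord crossing `ab` but none of the other diagonals must be `cd`. One that does not cross
    -- `ab` is an edge of `D` by maximality, and it is not `ab`, since it does not cross `cd`.
    by_cases hx : Cross a b p q
    · have hside : ∀ u v, IsEdge D u v → s(u, v) ≠ D k → ¬ Cross u v p q := by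
        rintro u v (h | ⟨i, hi⟩) h'
        · exact h.not_cross hp hq
        · exact hother i u v (by rintro rfl; exact h' hi.symm) hi
      have hn : ∀ u v, (u = c ∨ u = d ∨ v = c ∨ v = d) → s(u, v) ≠ D k := by
        intro u v h h'
        rw [hk, Sym2.eq_iff] at h'
        unfold Cyc at hc hd; omega
      have := eq_of_cross_diagonal (a := d) (b := c) (c := a) (d := b)
        (by unfold Cyc at *; omega) (by unfold Cyc at *; omega) hx
        (hside _ _ hda (hn _ _ (by simp))) (hside _ _ hac (hn _ _ (by simp)))
        (hside _ _ hcb (hn _ _ (by simp))) (hside _ _ hbd (hn _ _ (by simp)))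
      exact Or.inr ⟨k, by rw [Function.update_self, this, Sym2.eq_swap]⟩
    · refine hedge (hD.maximal hp hq hpq ?_) ?_
      · intro i u v hi
        by_cases hik : i = k
        · subst hik
          rw [hk, Sym2.eq_iff] at hi
          rcases hi with ⟨rfl, rfl⟩ | ⟨rfl, rfl⟩
          · exact hx
          · exact fun h => hx (hcross_swap h)
        · exact hother i u v hik hi
      · rw [hk]
        intro h
        rw [Sym2.eq_iff] at h
        apply hcdpq
        rcases h with ⟨rfl, rfl⟩ | ⟨rfl, rfl⟩
        · exact hcd.symm
        · exact (hcross_swap hcd).symm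

end Edge

/-! ### Seeds realized by triangulations; mutation as flip -/

/-- The indicator function of the label of the diagonal `ab`. -/
def ind {n : ℕ} (D : Fin n → Sym2 ℕ) (a b : ℕ) (j : Fin n) : ℕ :=
  if D j = s(a, b) then 1 else 0

/-- A symmetric function on pairs of vertices of a polygon that is `1` on the sides and satisfies
the Ptolemy relations. -/
structure IsPtolemy {F : Type*} [Field F] (n : ℕ) (l : ℕ → ℕ → F) : Prop where
  symm : ∀ a b, l a b = l b a
  self : ∀ a, l a a = 0
  side : ∀ {a b}, Side n a b → l a b = 1
  ptolemy : ∀ {a b c d}, Cyc a c b → Cyc b d a →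
    l a b * l c d = l a c * l b d + l c b * l d a

/-- The triangulation `D` is a model of the seed `S`: the cluster consists of the values of `l` on
the diagonals and the exchange matrix is the signed adjacency matrix. -/
structure Realizes {n : ℕ} {F : Type*} [Field F] (l : ℕ → ℕ → F) (S : SeedData n F)
    (D : Fin n → Sym2 ℕ) : Prop where
  triang : IsTriangulation D
  x_eq : ∀ {i a b}, D i = s(a, b) → S.x i = l a b
  skew : ∀ i j, S.B j i = -S.B i j
  column : ∀ k, ∃ a b c d, D k = s(a, b) ∧ Cyc a c b ∧ Cyc b d a ∧
    IsEdge D a c ∧ IsEdge D c b ∧ IsEdge D b d ∧ IsEdge D d a ∧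
    ∀ j, S.B j k = ind D a c j + ind D b d j - ind D c b j - ind D d a j

section Realizes

variable {n : ℕ} {F : Type*} [Field F] {l : ℕ → ℕ → F} {S : SeedData n F} {D : Fin n → Sym2 ℕ}

theorem ind_comm (D : Fin n → Sym2 ℕ) (a b : ℕ) (j : Fin n) : ind D a b j = ind D b a j := by
  unfold ind
  rw [Sym2.eq_swap]

theorem ind_of_ne {a b : ℕ} {j : Fin n} (h : D j ≠ s(a, b)) : ind D a b j = 0 :=
  if_neg h

theorem ind_of_eq {a b : ℕ} {j : Fin n} (h : D j = s(a, b)) : ind D a b j = 1 :=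
  if_pos h

theorem ind_eq_single (hD : IsTriangulation D) {a b : ℕ} {i : Fin n} (h : D i = s(a, b))
    (j : Fin n) : ind D a b j = if j = i then 1 else 0 := by
  unfold ind
  rw [← h]
  simp [hD.injective.eq_iff]

/-- A side carries no label and has value `1`, so the empty product is correct there and sides need
no separate treatment. -/
theorem Realizes.prod_edge (hS : Realizes l S D) (hl : IsPtolemy n l)
    {a b : ℕ} (h : IsEdge D a b) : ∏ j, S.x j ^ ind D a b j = l a b := by
  rcases h with h | ⟨i, hi⟩
  · rw [hl.side h]
    refine Finset.prod_eq_one fun j _ => ?_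
    rw [ind_of_ne, pow_zero]
    exact fun hj => (hS.triang.not_side hj).2 h
  · simp only [ind_eq_single hS.triang hi]
    rw [← hS.x_eq hi]
    simp [pow_ite]

/-- Column `k` of the exchange matrix, for any way of writing the quadrilateral around `D k`. -/
theorem Realizes.column_eq (hS : Realizes l S D) {k : Fin n} {a b c d : ℕ}
    (hk : D k = s(a, b)) (hc : Cyc a c b) (hd : Cyc b d a) (hac : IsEdge D a c)
    (hcb : IsEdge D c b) (hbd : IsEdge D b d) (hda : IsEdge D d a) (j : Fin n) :
    S.B j k = ind D a c j + ind D b d j - ind D c b j - ind D d a j := by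
  obtain ⟨a', b', c', d', hk', hc', hd', hac', hcb', hbd', hda', hB⟩ := hS.column k
  rw [hk, Sym2.eq_iff] at hk'
  rw [hB]
  rcases hk' with ⟨rfl, rfl⟩ | ⟨rfl, rfl⟩
  · rw [hS.triang.apex_unique hc hac hcb hc' hac' hcb',
      hS.triang.apex_unique hd hbd hda hd' hbd' hda']
  · rw [hS.triang.apex_unique hc hac hcb hd' hbd' hda',
      hS.triang.apex_unique hd hbd hda hc' hac' hcb']
    ring

/-- No label occurs with both signs in the column, so nothing cancels. The two parts are the
exponents of the two products in the Ptolemy relation. -/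
theorem Realizes.toNat_column (hS : Realizes l S D) {k : Fin n} {a b c d : ℕ}
    (hk : D k = s(a, b)) (hc : Cyc a c b) (hd : Cyc b d a) (hac : IsEdge D a c)
    (hcb : IsEdge D c b) (hbd : IsEdge D b d) (hda : IsEdge D d a) (j : Fin n) :
    (S.B j k).toNat = ind D a c j + ind D b d j ∧
      (-S.B j k).toNat = ind D c b j + ind D d a j := by
  have hne : D j = s(a, c) ∨ D j = s(b, d) → D j ≠ s(c, b) ∧ D j ≠ s(d, a) := by
    rintro (h | h) <;> rw [h] <;> simp only [ne_eq, Sym2.eq_iff] <;> unfold Cyc at * <;> omega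
  rw [hS.column_eq hk hc hd hac hcb hbd hda]
  by_cases h : D j = s(a, c) ∨ D j = s(b, d)
  · rw [ind_of_ne (hne h).1, ind_of_ne (hne h).2]
    omega
  · rw [not_or] at h
    rw [ind_of_ne h.1, ind_of_ne h.2]
    omega

theorem mutateMatrix_skew {B : Matrix (Fin n) (Fin n) ℤ} (hB : ∀ i j, B j i = -B i j)
    (k i j : Fin n) : mutateMatrix k B j i = -mutateMatrix k B i j := by
  have h0 : ∀ a : ℤ, max a 0 = a + max (-a) 0 := by intro a; omega
  simp only [mutateMatrix, Matrix.of_apply]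
  by_cases hi : i = k <;> by_cases hj : j = k <;> simp only [hi, hj, true_or, or_true, if_true,
    or_self, if_false]
  · exact congrArg _ (hB _ _)
  · exact congrArg _ (hB _ _)
  · exact congrArg _ (hB _ _)
  · rw [hB i j, hB k j, hB i k, neg_neg, h0 (-B k j), h0 (B i k), neg_neg]
    ring

/-- The new quadrilateral around a side of the flipped quadrilateral. -/
theorem Realizes.column_flip_side (hS : Realizes l S D) {k i : Fin n} {a b c d : ℕ}
    (hk : D k = s(a, b)) (hc : Cyc a c b) (hd : Cyc b d a) (hac : IsEdge D a c)
    (hcb : IsEdge D c b) (hbd : IsEdge D b d) (hda : IsEdge D d a)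
    (hi : D i = s(a, c) ∨ D i = s(c, b)) :
    ∃ a' b' c' d', Function.update D k s(c, d) i = s(a', b') ∧ Cyc a' c' b' ∧ Cyc b' d' a' ∧
      IsEdge (Function.update D k s(c, d)) a' c' ∧ IsEdge (Function.update D k s(c, d)) c' b' ∧
      IsEdge (Function.update D k s(c, d)) b' d' ∧ IsEdge (Function.update D k s(c, d)) d' a' ∧
      ∀ j, mutateMatrix k S.B j i = ind (Function.update D k s(c, d)) a' c' j +
        ind (Function.update D k s(c, d)) b' d' j - ind (Function.update D k s(c, d)) c' b' j -
        ind (Function.update D k s(c, d)) d' a' j := by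
  have hD := hS.triang
  have hab : IsEdge D a b := Or.inr ⟨k, hk⟩
  have hik : i ≠ k := by
    rintro rfl
    rw [hk, Sym2.eq_iff, Sym2.eq_iff] at hi
    unfold Cyc at hc; omega
  have hedge : ∀ {p q}, IsEdge D p q → s(p, q) ≠ s(a, b) →
      IsEdge (Function.update D k s(c, d)) p q := by
    rintro p q (h | ⟨j, hj⟩) h'
    · exact Or.inl h
    · refine Or.inr ⟨j, ?_⟩
      rw [Function.update_of_ne, hj]
      rintro rfl
      exact h' (hj.symm.trans hk)
  have hnew : IsEdge (Function.update D k s(c, d)) c d := Or.inr ⟨k, Function.update_self ..⟩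
  have hui : Function.update D k s(c, d) i = D i := Function.update_of_ne hik ..
  have hind : ∀ {p q j}, j ≠ k → ind (Function.update D k s(c, d)) p q j = ind D p q j := by
    intro p q j hj
    simp only [ind, Function.update_of_ne hj]
  have hindk : ∀ {p q}, s(c, d) ≠ s(p, q) → ind (Function.update D k s(c, d)) p q k = 0 := by
    intro p q h
    rw [ind_of_ne]
    rwa [Function.update_self]
  have hindcd : ind (Function.update D k s(c, d)) c d k = 1 :=
    ind_of_eq (Function.update_self ..)
  have hcd : ∀ j, j ≠ k → ind D c d j = 0 := by
    intro j hj
    exact ind_of_ne fun h => hD.not_cross hk h (Or.inl ⟨hc, hd⟩)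
  have hab' : ind D a b k = 1 := ind_of_eq hk
  have habj : ∀ j, j ≠ k → ind D a b j = 0 := by
    intro j hj
    exact ind_of_ne fun h => hj (hD.injective (h.trans hk.symm))
  have hmut : ∀ j, mutateMatrix k S.B j i = if j = k then -S.B k i else
      S.B j i + max (S.B j k) 0 * S.B k i + S.B j k * max (-S.B k i) 0 := by
    intro j
    simp only [mutateMatrix, Matrix.of_apply, hik, or_false]
    split_ifs with h
    · rw [h]
    · rfl
  have htn : ∀ j, max (S.B j k) 0 = ind D a c j + ind D b d j ∧
      max (-S.B j k) 0 = ind D c b j + ind D d a j := by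
    intro j
    have := hS.toNat_column hk hc hd hac hcb hbd hda j
    omega
  rcases hi with hi | hi
  · obtain ⟨f, _, hf, _, haf, hfc, -, -⟩ := hD.exists_quadrilateral hi
    have hfcb : Cyc a f b ∧ Cyc f c b ∧ Cyc f b a := by unfold Cyc at *; omega
    have hadc : Cyc c d a ∧ Cyc c b a ∧ Cyc f d a := by unfold Cyc at *; omega
    -- The triangle `a f c` beyond `ac` is untouched by the flip; on the other side of `ac` the apex
    -- `b` is replaced by `d`.
    refine ⟨a, c, f, d, hui.trans hi, hf, hadc.1, hedge haf ?_, hedge hfc ?_, hnew,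
      hedge hda ?_, ?_⟩
    iterate 3 (rw [Ne, Sym2.eq_iff]; unfold Cyc at *; omega)
    intro j
    have hcol := hS.column_eq hi hf hadc.2.1 haf hfc hcb hab.symm
    have hBk : S.B k i = -1 := by
      rw [hcol k, ind_comm D b a, hab']
      rw [ind_of_ne, ind_of_ne, ind_of_ne]
      · simp
      all_goals rw [hk, Ne, Sym2.eq_iff]; unfold Cyc at *; omega
    rw [hmut, hBk]
    split_ifs with hj
    · subst hj
      rw [hindcd, hindk, hindk, hindk]
      · simp
      all_goals rw [Ne, Sym2.eq_iff]; unfold Cyc at *; omega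
    -- Since `B k i = -1`, mutation subtracts the negative part of column `k`, which removes `cb`
    -- and adds `da` with a minus sign.
    · rw [hind hj, hind hj, hind hj, hind hj, hcol, hcd j hj, ind_comm D b a, habj j hj]
      have := htn j
      simp only [neg_neg, mul_neg, mul_one, show max (1 : ℤ) 0 = 1 from rfl]
      omega
  · obtain ⟨f, _, hf, _, hcf, hfb, -, -⟩ := hD.exists_quadrilateral hi
    have hfcb : Cyc b a c ∧ Cyc b d c ∧ Cyc a f b := by unfold Cyc at *; omega
    refine ⟨c, b, f, d, hui.trans hi, hf, hfcb.2.1, hedge hcf ?_, hedge hfb ?_, hedge hbd ?_,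
      hnew.symm, ?_⟩
    iterate 3 (rw [Ne, Sym2.eq_iff]; unfold Cyc at *; omega)
    intro j
    have hcol := hS.column_eq hi hf hfcb.1 hcf hfb hab.symm hac
    have hBk : S.B k i = 1 := by
      rw [hcol k, ind_comm D b a, hab']
      rw [ind_of_ne, ind_of_ne, ind_of_ne]
      · simp
      all_goals rw [hk, Ne, Sym2.eq_iff]; unfold Cyc at *; omega
    rw [hmut, hBk]
    split_ifs with hj
    · subst hj
      rw [ind_comm _ d c, hindcd, hindk, hindk, hindk]
      · simp
      all_goals rw [Ne, Sym2.eq_iff]; unfold Cyc at *; omega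
    · rw [hind hj, hind hj, hind hj, hind hj, hcol, ind_comm D d c, hcd j hj, ind_comm D b a,
        habj j hj]
      have := htn j
      simp only [mul_one, mul_zero, show max (-1 : ℤ) 0 = 0 from rfl]
      omega

/-- Mutation of a seed corresponds to a flip of its triangulation. -/
theorem Realizes.mutate (hS : Realizes l S D) (hl : IsPtolemy n l) (hx : ∀ i, S.x i ≠ 0)
    (k : Fin n) : ∃ D', Realizes l (S.mutate k) D' := by
  obtain ⟨a, b, c, d, hk, hc, hd, hac, hcb, hbd, hda, hB⟩ := hS.column k
  have hD := hS.triang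
  have hD' := hD.flip hk hc hd hac hcb hbd hda
  have hne : c ≠ d := by unfold Cyc at *; omega
  refine ⟨Function.update D k s(c, d), hD', ?_, mutateMatrix_skew hS.skew k, ?_⟩
  · intro i u v hi
    simp only [SeedData.mutate]
    split_ifs with hik
    · subst hik
      rw [Function.update_self] at hi
      have hluv : l u v = l c d := by
        rcases Sym2.eq_iff.1 hi with ⟨rfl, rfl⟩ | ⟨rfl, rfl⟩
        · rfl
        · exact hl.symm _ _
      rw [hluv, inv_mul_eq_iff_eq_mul₀ (hx i), hS.x_eq hk, hl.ptolemy hc hd,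
        ← hS.prod_edge hl hac, ← hS.prod_edge hl hbd, ← hS.prod_edge hl hcb,
        ← hS.prod_edge hl hda, ← Finset.prod_mul_distrib, ← Finset.prod_mul_distrib]
      congr 1
      · refine Finset.prod_congr rfl fun j _ => ?_
        rw [(hS.toNat_column hk hc hd hac hcb hbd hda j).1, pow_add]
      · refine Finset.prod_congr rfl fun j _ => ?_
        rw [(hS.toNat_column hk hc hd hac hcb hbd hda j).2, pow_add]
    · rw [Function.update_of_ne hik] at hi
      exact hS.x_eq hi
  · intro i
    simp only [SeedData.mutate]
    by_cases h1 : D i = s(a, c) ∨ D i = s(c, b)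
    · exact hS.column_flip_side hk hc hd hac hcb hbd hda h1
    by_cases h2 : D i = s(b, d) ∨ D i = s(d, a)
    · have := hS.column_flip_side (hk.trans Sym2.eq_swap) hd hc hbd hda hac hcb h2
      rwa [Sym2.eq_swap (a := d)] at this
    have hedge : ∀ {p q}, IsEdge D p q → s(p, q) ≠ s(a, b) →
        IsEdge (Function.update D k s(c, d)) p q := by
      rintro p q (h | ⟨j, hj⟩) h'
      · exact Or.inl h
      · refine Or.inr ⟨j, ?_⟩
        rw [Function.update_of_ne, hj]
        rintro rfl
        exact h' (hj.symm.trans hk)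
    have hind : ∀ {p q j}, j ≠ k → ind (Function.update D k s(c, d)) p q j = ind D p q j := by
      intro p q j hj
      simp only [ind, Function.update_of_ne hj]
    have hindk : ∀ {p q}, s(c, d) ≠ s(p, q) → ind (Function.update D k s(c, d)) p q k = 0 := by
      intro p q h
      rw [ind_of_ne]
      rwa [Function.update_self]
    by_cases hik : i = k
    · subst hik
      have hcb' : Cyc c b d ∧ Cyc d a c := by unfold Cyc at *; omega
      refine ⟨c, d, b, a, Function.update_self .., hcb'.1, hcb'.2, hedge hcb ?_, hedge hbd ?_,
        hedge hda ?_, hedge hac ?_, ?_⟩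
      iterate 4 (rw [Ne, Sym2.eq_iff]; unfold Cyc at *; omega)
      intro j
      simp only [mutateMatrix, Matrix.of_apply, or_true, if_true]
      by_cases hj : j = i
      · subst hj
        have h0 : S.B j j = 0 := by have := hS.skew j j; omega
        rw [h0, hindk, hindk, hindk, hindk]
        · simp
        all_goals rw [Ne, Sym2.eq_iff]; unfold Cyc at *; omega
      · rw [hind hj, hind hj, hind hj, hind hj, hB]
        ring
    · rw [not_or] at h1 h2
      have hBik : S.B i k = 0 := by
        rw [hB, ind_of_ne h1.1, ind_of_ne h1.2, ind_of_ne h2.1, ind_of_ne h2.2]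
        simp
      have hBki : S.B k i = 0 := by rw [hS.skew, hBik, neg_zero]
      obtain ⟨a', b', c', d', hi, hc', hd', hac', hcb', hbd', hda', hB'⟩ := hS.column i
      -- A vanishing entry has vanishing positive and negative parts, so `D k` is no side of the
      -- quadrilateral around `D i`, and the flip leaves that quadrilateral intact.
      have hsides : D k ≠ s(a', c') ∧ D k ≠ s(c', b') ∧ D k ≠ s(b', d') ∧ D k ≠ s(d', a') := by
        have htn := hS.toNat_column hi hc' hd' hac' hcb' hbd' hda' k
        rw [hBki] at htn
        refine ⟨?_, ?_, ?_, ?_⟩ <;> intro h <;> rw [ind_of_eq h] at htn <;>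
          simp at htn <;> omega
      rw [hk] at hsides
      refine ⟨a', b', c', d', (Function.update_of_ne hik ..).trans hi, hc', hd',
        hedge hac' hsides.1.symm, hedge hcb' hsides.2.1.symm, hedge hbd' hsides.2.2.1.symm,
        hedge hda' hsides.2.2.2.symm, ?_⟩
      intro j
      by_cases hj : j = k
      · subst hj
        have hnc : ∀ {p q}, IsEdge D p q → s(c, d) ≠ s(p, q) := by
          intro p q h h'
          have : Cross a b p q := by
            rcases Sym2.eq_iff.1 h' with ⟨rfl, rfl⟩ | ⟨rfl, rfl⟩
            · exact Or.inl ⟨hc, hd⟩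
            · exact Or.inr ⟨hc, hd⟩
          exact hD.edge_not_cross (Or.inr ⟨j, hk⟩) h this
        rw [hindk (hnc hac'), hindk (hnc hcb'), hindk (hnc hbd'), hindk (hnc hda')]
        simp [mutateMatrix, hBki]
      · rw [hind hj, hind hj, hind hj, hind hj, ← hB']
        simp [mutateMatrix, hBki, hj, hik]

end Realizes

/-! ### The Ptolemy function of a fan and the linearly oriented seed -/

section Fan

variable {n : ℕ} {F : Type*} [Field F]

/-- The values of a Ptolemy function on the chords at the vertex `0`, given the values `x k` on
the chords from `0` to `k + 2`. -/
noncomputable def fanValue (x : Fin n → F) (j : ℕ) : F :=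
  if h : 2 ≤ j ∧ j - 2 < n then x ⟨j - 2, h.2⟩ else 1

/-- The value on the chord from `i` to `j`, for `i < j`. -/
noncomputable def fanChord (x : Fin n → F) (i j : ℕ) : F :=
  if i = 0 then fanValue x j
  else fanValue x i * fanValue x j *
    ∑ m ∈ Ico i j, (fanValue x m * fanValue x (m + 1))⁻¹

/-- The Ptolemy function with given values on the diagonals at the vertex `0`. -/
noncomputable def fanPtolemy (x : Fin n → F) (a b : ℕ) : F :=
  if a = b then 0 else if a < b then fanChord x a b else fanChord x b a

theorem fanValue_ne_zero {x : Fin n → F} (hx : ∀ i, x i ≠ 0) (j : ℕ) : fanValue x j ≠ 0 := by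
  unfold fanValue
  split_ifs
  · exact hx _
  · exact one_ne_zero

theorem fanPtolemy_symm (x : Fin n → F) (a b : ℕ) : fanPtolemy x a b = fanPtolemy x b a := by
  unfold fanPtolemy
  rcases lt_trichotomy a b with h | h | h
  · rw [if_neg h.ne, if_pos h, if_neg h.ne', if_neg h.not_gt]
  · rw [h]
  · rw [if_neg h.ne', if_neg h.not_gt, if_neg h.ne, if_pos h]

theorem fanPtolemy_of_lt (x : Fin n → F) {a b : ℕ} (h : a < b) :
    fanPtolemy x a b = fanChord x a b := by
  rw [fanPtolemy, if_neg h.ne, if_pos h]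

/-- Divided by the chords from `0` to its endpoints, a chord between nonzero vertices becomes
additive along the polygon. The relation is then `(u + v) * (v + w) = u * w + v * (u + v + w)`, or
additivity itself if `a = 0`. -/
theorem fanPtolemy_relation (x : Fin n → F) {a b c d : ℕ} (hab : a < b) (hbc : b < c)
    (hcd : c < d) : fanPtolemy x a c * fanPtolemy x b d =
      fanPtolemy x a b * fanPtolemy x c d + fanPtolemy x b c * fanPtolemy x a d := by
  rw [fanPtolemy_of_lt x hab, fanPtolemy_of_lt x hbc, fanPtolemy_of_lt x hcd,
    fanPtolemy_of_lt x (hab.trans hbc), fanPtolemy_of_lt x (hbc.trans hcd),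
    fanPtolemy_of_lt x ((hab.trans hbc).trans hcd)]
  unfold fanChord
  have hb : b ≠ 0 := by omega
  have hc : c ≠ 0 := by omega
  simp only [if_neg hb, if_neg hc]
  rw [← Finset.sum_Ico_consecutive _ hbc.le hcd.le]
  split_ifs
  · ring
  · rw [← Finset.sum_Ico_consecutive _ hab.le (hbc.trans hcd).le,
      ← Finset.sum_Ico_consecutive _ hab.le hbc.le, ← Finset.sum_Ico_consecutive _ hbc.le hcd.le]
    ring

theorem isPtolemy_fanPtolemy {x : Fin n → F} (hx : ∀ i, x i ≠ 0) :
    IsPtolemy n (fanPtolemy x) := by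
  have hs := fanPtolemy_symm x
  have hlt : ∀ {a b}, a < b → Side n a b → fanPtolemy x a b = 1 := by
    intro a b hab h
    rw [fanPtolemy_of_lt x hab, fanChord]
    split_ifs with ha
    -- The sides from `0` to `1` and to `n + 2` fall under the default value `1` of `fanValue`.
    · rw [fanValue, dif_neg]
      unfold Side at h; omega
    · have hb : b = a + 1 := by unfold Side at h; omega
      subst hb
      simp only [Nat.Ico_succ_singleton, Finset.sum_singleton]
      exact mul_inv_cancel₀ (mul_ne_zero (fanValue_ne_zero hx _) (fanValue_ne_zero hx _))
  refine ⟨hs, fun a => if_pos rfl, ?_, ?_⟩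
  · intro a b h
    rcases lt_trichotomy a b with hab | hab | hab
    · exact hlt hab h
    · unfold Side at h; omega
    · rw [hs]; exact hlt hab h.symm
  · intro a b c d hc hd
    -- The cases record which of the four cyclically ordered vertices has the smallest number.
    have hcase : (a < c ∧ c < b ∧ b < d) ∨ (c < b ∧ b < d ∧ d < a) ∨ (b < d ∧ d < a ∧ a < c) ∨
        (d < a ∧ a < c ∧ c < b) := by unfold Cyc at *; omega
    rcases hcase with ⟨h1, h2, h3⟩ | ⟨h1, h2, h3⟩ | ⟨h1, h2, h3⟩ | ⟨h1, h2, h3⟩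
    · rw [fanPtolemy_relation x h1 h2 h3, hs d a]
    · have := fanPtolemy_relation x h1 h2 h3
      rw [hs a b, hs a c]; linear_combination this
    · have := fanPtolemy_relation x h1 h2 h3
      rw [hs a b, hs c d, hs c b]; linear_combination this
    · have := fanPtolemy_relation x h1 h2 h3
      rw [hs c d, hs b d]; linear_combination this

/-- The diagonals at the vertex `0`, labelled through `τ`. -/
def fan (τ : Equiv.Perm (Fin n)) (j : Fin n) : Sym2 ℕ := s(0, (τ j : ℕ) + 2)

theorem fan_eq {τ : Equiv.Perm (Fin n)} {j : Fin n} {a b : ℕ} :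
    fan τ j = s(a, b) ↔ (a = 0 ∧ b = (τ j : ℕ) + 2) ∨ (b = 0 ∧ a = (τ j : ℕ) + 2) := by
  rw [fan, Sym2.eq_iff]
  omega

theorem isTriangulation_fan (τ : Equiv.Perm (Fin n)) : IsTriangulation (fan τ) where
  injective := by
    intro i j h
    have := fan_eq.1 h
    exact τ.injective (Fin.ext (by omega))
  lt := by
    intro i a b h
    have := fan_eq.1 h
    omega
  not_side := by
    intro i a b h
    have := fan_eq.1 h
    unfold Side
    omega
  not_cross := by
    intro i j a b p q h h'
    have := fan_eq.1 h
    have := fan_eq.1 h'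
    unfold Cross Cyc
    omega
  maximal := by
    have key : ∀ p q, p < q → q < n + 3 →
        (∀ i a b, fan τ i = s(a, b) → ¬ Cross a b p q) → IsEdge (fan τ) p q := by
      intro p q hpq hq h
      by_cases hs : Side n p q
      · exact Or.inl hs
      have hp0 : p = 0 := by
        by_contra hp
        have hp' : p - 1 < n := by unfold Side at hs; omega
        -- A chord avoiding `0` that is not a side cuts off the vertex `p + 1`, so it crosses the
        -- fan diagonal ending there, whose index is `p - 1`.
        apply h (τ.symm ⟨p - 1, hp'⟩) 0 (p + 1) (by rw [fan_eq]; left; simp; omega)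
        unfold Side at hs; unfold Cross Cyc; omega
      have hq' : q - 2 < n := by unfold Side at hs; omega
      refine Or.inr ⟨τ.symm ⟨q - 2, hq'⟩, ?_⟩
      rw [fan_eq]
      left
      unfold Side at hs
      simp
      omega
    intro p q hp hq hpq h
    rcases lt_or_gt_of_ne hpq with h' | h'
    · exact key p q h' hq h
    · refine (key q p h' hp fun i a b hi hx => h i a b hi ?_).symm
      unfold Cross at *; tauto

/-- `B` is the exchange matrix of a quiver whose underlying graph is a path; the vertices are
arranged along the path by `σ`, and `ε` records the orientations. -/
structure IsPath (B : Matrix (Fin n) (Fin n) ℤ) (σ : Equiv.Perm (Fin n)) (ε : ℕ → ℤ) : Prop where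
  sign : ∀ i, ε i = 1 ∨ ε i = -1
  apply : ∀ i j : Fin n, B (σ i) (σ j) =
    if (i : ℕ) + 1 = j then ε i else if (j : ℕ) + 1 = i then -ε j else 0

/-- The seed with a linearly oriented path as its quiver is realized by a fan. -/
theorem realizes_fan {S : SeedData n F} {σ : Equiv.Perm (Fin n)} {ε : ℕ → ℤ}
    (hB : IsPath S.B σ ε) (hε : ∀ i, i + 1 < n → ε i = 1) :
    Realizes (fanPtolemy (S.x ∘ σ)) S (fan σ.symm) where
  triang := isTriangulation_fan _
  x_eq := by
    have key : ∀ i : Fin n, S.x i = fanPtolemy (S.x ∘ σ) 0 ((σ.symm i : ℕ) + 2) := by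
      intro i
      rw [fanPtolemy_of_lt _ (by omega), fanChord, if_pos rfl, fanValue, dif_pos]
      · simp
      · simp
    intro i a b h
    rcases fan_eq.1 h with ⟨rfl, rfl⟩ | ⟨rfl, rfl⟩
    · exact key i
    · rw [fanPtolemy_symm]; exact key i
  skew := by
    intro i j
    have h1 := hB.apply (σ.symm i) (σ.symm j)
    have h2 := hB.apply (σ.symm j) (σ.symm i)
    simp only [Equiv.apply_symm_apply] at h1 h2
    rw [h1, h2]
    split_ifs <;> omega
  column := by
    intro k
    have hk := (σ.symm k).2
    have hedge : ∀ q, 0 < q → q < n + 3 → IsEdge (fan σ.symm) 0 q := by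
      intro q h0 hq
      by_cases hs : Side n 0 q
      · exact Or.inl hs
      · have hq' : q - 2 < n := by unfold Side at hs; omega
        refine Or.inr ⟨σ ⟨q - 2, hq'⟩, ?_⟩
        rw [fan_eq]
        left
        unfold Side at hs
        simp
        omega
    -- The two apexes are the neighbouring vertices; the chords from `0` to them are the adjacent
    -- fan diagonals, or sides at the ends of the path.
    refine ⟨0, (σ.symm k : ℕ) + 2, (σ.symm k : ℕ) + 1, (σ.symm k : ℕ) + 3, rfl, ?_, ?_,
      hedge _ (by omega) (by omega), Or.inl ?_, Or.inl ?_,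
      (hedge _ (by omega) (by omega)).symm, ?_⟩
    · unfold Cyc; omega
    · unfold Cyc; omega
    · unfold Side; omega
    · unfold Side; omega
    intro j
    have h1 := hB.apply (σ.symm j) (σ.symm k)
    simp only [Equiv.apply_symm_apply] at h1
    rw [h1]
    unfold ind
    simp only [fan_eq]
    have := (σ.symm j).2
    have h3 := hε (σ.symm j)
    have h4 := hε (σ.symm k)
    generalize (σ.symm j : ℕ) = p at *
    generalize (σ.symm k : ℕ) = q at *
    by_cases h5 : p + 1 = q
    · subst h5
      simp [h3 (by omega)]
    by_cases h6 : q + 1 = p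
    · subst h6
      simp [h4 (by omega)]
      omega
    have h7 : q + 3 ≠ p + 2 := by omega
    simp [h5, h6, h7]
    omega

end Fan

/-! ### Orientations of a path -/

section Orientation

variable {n : ℕ}

/-- Mutation of a path at a sink or source. -/
theorem IsPath.mutate {B : Matrix (Fin n) (Fin n) ℤ} {σ : Equiv.Perm (Fin n)} {ε : ℕ → ℤ}
    (h : IsPath B σ ε) (k : Fin n) (hk : ∀ i, i + 1 = (k : ℕ) → ε i = -ε k) :
    IsPath (mutateMatrix (σ k) B) σ (fun i => if i = k ∨ i + 1 = k then -ε i else ε i) where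
  sign := by
    intro i
    have := h.sign i
    split_ifs <;> omega
  apply := by
    intro i j
    simp only [mutateMatrix, Matrix.of_apply, h.apply, σ.injective.eq_iff]
    simp only [Fin.ext_iff]
    have hs := h.sign k
    have hi := hk i
    have hj := hk j
    by_cases h1 : (i : ℕ) = k
    · split_ifs <;> omega
    by_cases h2 : (j : ℕ) = k
    · split_ifs <;> omega
    simp only [h1, h2, or_self, false_or, if_false]
    by_cases h3 : (i : ℕ) + 1 = k
    · by_cases h4 : (j : ℕ) + 1 = k
      · have h5 : (i : ℕ) = j := by omega
        simp only [h4, h5, if_true]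
        rcases hs with hs | hs <;> (rw [hs] at hi hj; simp [hs, hj h4]; try omega)
      · by_cases h5 : (k : ℕ) + 1 = j
        · simp only [h3, h5, if_true, hi h3]
          rcases hs with hs | hs <;> rw [hs] <;> simp <;> omega
        · simp [h3, h4, h5, Ne.symm h2]
    · by_cases h4 : (k : ℕ) + 1 = i
      · by_cases h5 : (j : ℕ) + 1 = k
        · simp only [h3, h4, h5, if_true, if_false, hj h5]
          rcases hs with hs | hs <;> rw [hs] <;> simp <;> omega
        · by_cases h6 : (k : ℕ) + 1 = j
          · simp only [h3, h4, if_true, if_false]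
            rcases hs with hs | hs <;> rw [hs] <;> simp <;> omega
          · have h7 : (i : ℕ) ≠ j := by omega
            simp [h3, h4, h5, h7]
      · simp only [h3, h4, if_false, zero_mul, max_self, add_zero]
        split_ifs <;> omega

/-- When the edges on both sides of vertex `j` have opposite signs, `j` is a sink or source and
mutation there reverses both. The single wrong sign thus moves from `j` to `j - 1` and disappears at
the end of the path. The value `ε (n - 1)` belongs to no edge, but its sign can be treated in the
same way. -/
theorem exists_path_orient_of_single {X : Type*} (B : X → Matrix (Fin n) (Fin n) ℤ)
    (hmut : ∀ t k, ∃ t', B t' = mutateMatrix k (B t)) (σ : Equiv.Perm (Fin n)) (m : ℕ)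
    (hm : m < n) (j : ℕ) : ∀ t ε, j ≤ m → IsPath (B t) σ ε → ε j = -1 →
      (∀ i ≤ m, i ≠ j → ε i = 1) → ∃ t ε, IsPath (B t) σ ε ∧ ∀ i ≤ m, ε i = 1 := by
  induction j with
  | zero =>
    intro t ε hj h h0 hi
    obtain ⟨t', ht'⟩ := hmut t (σ ⟨0, by omega⟩)
    refine ⟨t', _, ht' ▸ h.mutate ⟨0, by omega⟩ (by intro i h; simp at h), ?_⟩
    intro i him
    simp only [Nat.add_eq_zero_iff, one_ne_zero, and_false, or_false]
    split_ifs with h'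
    · rw [h', h0, neg_neg]
    · exact hi i him h'
  | succ j ih =>
    intro t ε hj h h0 hi
    obtain ⟨t', ht'⟩ := hmut t (σ ⟨j + 1, by omega⟩)
    have hj1 := hi j (by omega) (by omega)
    have := h.mutate ⟨j + 1, by omega⟩ (by
      intro i h'
      have : i = j := by simpa using h'
      subst this
      simp only
      omega)
    refine ih t' _ (by omega) (ht' ▸ this) ?_ ?_
    · simp [hj1]
    · intro i him hij
      simp only [add_left_inj, hij, or_false]
      split_ifs with heq
      · rw [heq, h0, neg_neg]
      · exact hi i him heq

/-- Every orientation of a path is mutation-equivalent to the linear one. -/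
theorem exists_path_orient {X : Type*} (B : X → Matrix (Fin n) (Fin n) ℤ)
    (hmut : ∀ t k, ∃ t', B t' = mutateMatrix k (B t)) (σ : Equiv.Perm (Fin n)) (t : X)
    (ε : ℕ → ℤ) (h : IsPath (B t) σ ε) (m : ℕ) (hm : m ≤ n) :
    ∃ t ε, IsPath (B t) σ ε ∧ ∀ i < m, ε i = 1 := by
  induction m with
  | zero => exact ⟨t, ε, h, by simp⟩
  | succ m ih =>
    obtain ⟨t, ε, h, hε⟩ := ih (by omega)
    rcases h.sign m with h1 | h1
    · refine ⟨t, ε, h, fun i hi => ?_⟩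
      rcases Nat.lt_succ_iff_lt_or_eq.1 hi with h' | h'
      · exact hε i h'
      · rw [h', h1]
    · obtain ⟨t, ε, h, hε⟩ := exists_path_orient_of_single B hmut σ m (by omega) m t ε le_rfl h h1
        (fun i hi hne => hε i (by omega))
      exact ⟨t, ε, h, fun i hi => hε i (by omega)⟩

/-- A skew-symmetrizable matrix with the Cartan counterpart of type `A` is that of a path. -/
theorem exists_isPath {B : Matrix (Fin n) (Fin n) ℤ} (hB : IsSkewSymmetrizable B)
    {σ : Equiv.Perm (Fin n)} (h : (cartanCounterpart B).submatrix σ σ = CartanMatrix.A n) :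
    ∃ ε, IsPath B σ ε := by
  obtain ⟨d, hd, hdB⟩ := hB
  have hskew : ∀ i j, d j * B j i = -(d i * B i j) := by
    intro i j
    have := congrFun (congrFun hdB i) j
    simpa [Matrix.diagonal_mul] using this
  have habs : ∀ i j, i ≠ j → |B (σ i) (σ j)| =
      if (i : ℕ) + 1 = j ∨ (j : ℕ) + 1 = i then 1 else 0 := by
    intro i j hij
    have := congrFun (congrFun h i) j
    simp only [cartanCounterpart, CartanMatrix.A, Matrix.submatrix_apply, Matrix.of_apply,
      σ.injective.eq_iff, hij, if_false] at this
    split_ifs at this ⊢ <;> omega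
  -- Skew-symmetrizability makes opposite entries of opposite sign, and both have absolute value
  -- `1`.
  have hval : ∀ i j : Fin n, (i : ℕ) + 1 = j →
      (B (σ i) (σ j) = 1 ∨ B (σ i) (σ j) = -1) ∧ B (σ j) (σ i) = -B (σ i) (σ j) := by
    intro i j hij
    have hne : i ≠ j := by rintro rfl; omega
    have h1 := habs i j hne
    have h2 := habs j i hne.symm
    have h3 := hskew (σ i) (σ j)
    have h4 := hd (σ i)
    have h5 := hd (σ j)
    rw [if_pos (Or.inl hij)] at h1
    rw [if_pos (Or.inr hij)] at h2
    rcases (abs_eq (by norm_num)).1 h1 with h1 | h1 <;>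
      rcases (abs_eq (by norm_num)).1 h2 with h2 | h2 <;> rw [h1, h2] at h3 <;>
      rw [h1, h2] <;> omega
  classical
  refine ⟨fun i => if h : i + 1 < n then B (σ ⟨i, by omega⟩) (σ ⟨i + 1, h⟩) else 1, ?_, ?_⟩
  · intro i
    split_ifs with h'
    · exact (hval ⟨i, _⟩ ⟨i + 1, h'⟩ rfl).1
    · exact Or.inl rfl
  · intro i j
    split_ifs with h1 h2 h3 h4
    · congr 3
      exact Fin.ext h1.symm
    · omega
    · have := (hval j i h3).2
      rw [this]
      congr 4
      exact Fin.ext h3.symm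
    · omega
    · by_cases hij : i = j
      · subst hij
        have := hskew (σ i) (σ i)
        have h0 : d (σ i) * B (σ i) (σ i) = 0 := by omega
        exact (mul_eq_zero.1 h0).resolve_left (hd _).ne'
      · have := habs i j hij
        rw [if_neg (by tauto)] at this
        exact abs_eq_zero.1 this

end Orientation

/-! ### The kernel of the exchange matrix under mutation -/

section Kernel

variable {n : ℕ}

/-- The kernel of `B` has rank at most one. -/
def KernelRankLEOne (B : Matrix (Fin n) (Fin n) ℤ) : Prop :=
  ∀ v w : Fin n → ℤ, (∀ i, ∑ j, B i j * v j = 0) → (∀ i, ∑ j, B i j * w j = 0) →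
    ∃ α β : ℤ, (α ≠ 0 ∨ β ≠ 0) ∧ ∀ i, α * v i + β * w i = 0

/-- Mutation at `k` has the form `E * B * G`, where `G` differs from the identity only in row `k`,
with entries `max (-B k j) 0` and diagonal entry `-1`. As `G` is an involution, it carries the
kernel of `B` to that of the mutated matrix; the updated vector is `G` applied to `v`. -/
theorem mutateMatrix_kernel {B : Matrix (Fin n) (Fin n) ℤ} (k : Fin n) (hk : B k k = 0)
    {v : Fin n → ℤ} (hv : ∀ i, ∑ j, B i j * v j = 0) (i : Fin n) :
    ∑ j, mutateMatrix k B i j *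
      Function.update v k (-v k + ∑ j, max (-B k j) 0 * v j) j = 0 := by
  have hsplit : ∀ f g : Fin n → ℤ, f k * g k + ∑ j ∈ univ.erase k, f j * g j = ∑ j, f j * g j :=
    fun f g => Finset.add_sum_erase univ (fun j => f j * g j) (mem_univ k)
  have hv' := hsplit (B k) v
  rw [hv k, hk, zero_mul, zero_add] at hv'
  have hm := hsplit (fun j => max (-B k j) 0) v
  rw [hk, neg_zero, max_self, zero_mul, zero_add] at hm
  rw [← hsplit, Function.update_self]
  have hne : ∀ j ∈ univ.erase k, Function.update v k (-v k + ∑ j, max (-B k j) 0 * v j) j = v j :=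
    fun j hj => Function.update_of_ne (Finset.ne_of_mem_erase hj) ..
  rw [Finset.sum_congr rfl fun j hj => congrArg (mutateMatrix k B i j * ·) (hne j hj)]
  by_cases hi : i = k
  · subst hi
    simp only [mutateMatrix, Matrix.of_apply, true_or, if_true, neg_mul, Finset.sum_neg_distrib,
      hv', hk]
    simp
  · have h1 : ∀ j ∈ univ.erase k, mutateMatrix k B i j * v j =
        B i j * v j + max (B i k) 0 * (B k j * v j) + B i k * (max (-B k j) 0 * v j) := by
      intro j hj
      simp only [mutateMatrix, Matrix.of_apply, hi, Finset.ne_of_mem_erase hj, or_self, if_false]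
      ring
    have h2 := hsplit (B i) v
    rw [hv i] at h2
    rw [Finset.sum_congr rfl h1, Finset.sum_add_distrib, Finset.sum_add_distrib,
      ← Finset.mul_sum, ← Finset.mul_sum, hv', hm]
    simp only [mutateMatrix, Matrix.of_apply, or_true, if_true]
    linear_combination h2

/-- A linear relation between the transformed vectors holds for the original ones away from `k`, and
then also at `k`, since the new entry is `-v k` plus a combination of the other entries. -/
theorem KernelRankLEOne.of_mutate {B : Matrix (Fin n) (Fin n) ℤ} {k : Fin n} (hk : B k k = 0)
    (h : KernelRankLEOne (mutateMatrix k B)) : KernelRankLEOne B := by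
  intro v w hv hw
  obtain ⟨α, β, hαβ, h0⟩ := h _ _ (mutateMatrix_kernel k hk hv) (mutateMatrix_kernel k hk hw)
  refine ⟨α, β, hαβ, ?_⟩
  have hne : ∀ i, i ≠ k → α * v i + β * w i = 0 := by
    intro i hi
    have := h0 i
    rwa [Function.update_of_ne hi, Function.update_of_ne hi] at this
  intro i
  by_cases hi : i = k
  · subst hi
    have := h0 i
    rw [Function.update_self, Function.update_self] at this
    have hs : α * ∑ j, max (-B i j) 0 * v j + β * ∑ j, max (-B i j) 0 * w j = 0 := by
      rw [Finset.mul_sum, Finset.mul_sum, ← Finset.sum_add_distrib]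
      refine Finset.sum_eq_zero fun j _ => ?_
      by_cases hj : j = i
      · subst hj; simp [hk]
      · linear_combination max (-B i j) 0 * hne j hj
    linear_combination hs - this
  · exact hne i hi

/-- Row `m` of the kernel equations determines the entry at vertex `m + 1` from the one at `m - 1`,
so a kernel vector is determined by its first entry. A combination of two kernel vectors that
cancels the first entry is zero. -/
theorem IsPath.kernelRankLEOne (hn : 0 < n) {B : Matrix (Fin n) (Fin n) ℤ}
    {σ : Equiv.Perm (Fin n)} {ε : ℕ → ℤ} (h : IsPath B σ ε) : KernelRankLEOne B := by
  have key : ∀ u : Fin n → ℤ, (∀ i, ∑ j, B i j * u j = 0) → u (σ ⟨0, hn⟩) = 0 →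
      ∀ i, u i = 0 := by
    intro u hu h0
    have hrow : ∀ i : Fin n, ∑ j : Fin n, (if (i : ℕ) + 1 = j then ε i
        else if (j : ℕ) + 1 = i then -ε j else 0) * u (σ j) = 0 := by
      intro i
      refine Eq.trans ?_ (hu (σ i))
      rw [← Equiv.sum_comp σ fun j => B (σ i) j * u j]
      exact Finset.sum_congr rfl fun j _ => by rw [h.apply]
    have hε : ∀ i, ε i ≠ 0 := by
      intro i
      have := h.sign i
      omega
    have step : ∀ m (hm : m < n), u (σ ⟨m, hm⟩) = 0 := by
      intro m
      induction m using Nat.strong_induction_on with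
      | _ m ih =>
        intro hm
        rcases m with _ | m
        · exact h0
        have hr := hrow ⟨m, by omega⟩
        rw [Finset.sum_eq_single ⟨m + 1, hm⟩] at hr
        · simpa [hε] using hr
        · intro j _ hj
          have hj' : m + 1 ≠ (j : ℕ) := fun h => hj (Fin.ext h.symm)
          simp only [hj', if_false]
          split_ifs with h'
          · rw [ih j (by omega) j.2, mul_zero]
          · rw [zero_mul]
        · simp
    intro i
    have := step (σ.symm i) (σ.symm i).2
    simpa using this
  intro v w hv hw
  by_cases h0 : v (σ ⟨0, hn⟩) = 0
  · exact ⟨1, 0, Or.inl one_ne_zero, fun i => by rw [key v hv h0 i]; ring⟩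
  · refine ⟨w (σ ⟨0, hn⟩), -v (σ ⟨0, hn⟩), Or.inr (neg_ne_zero.2 h0), ?_⟩
    refine key (fun i => w (σ ⟨0, hn⟩) * v i + -v (σ ⟨0, hn⟩) * w i) ?_ (by ring)
    intro i
    have : ∀ j, B i j * (w (σ ⟨0, hn⟩) * v j + -v (σ ⟨0, hn⟩) * w j) =
        w (σ ⟨0, hn⟩) * (B i j * v j) - v (σ ⟨0, hn⟩) * (B i j * w j) := fun j => by ring
    simp only [this, Finset.sum_sub_distrib, ← Finset.mul_sum, hv, hw]
    ring

end Kernel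

/-! ### Laurent monomials and squarefree sums in the `ŷ k` -/

section Laurent

variable {n : ℕ} {F : Type*} [Field F]

/-- The Laurent monomial with exponent vector `g`. -/
def laurent (x : Fin n → F) (g : Fin n → ℤ) : F := ∏ j, x j ^ g j

theorem laurent_add {x : Fin n → F} (hx : ∀ i, x i ≠ 0) (g h : Fin n → ℤ) :
    laurent x (g + h) = laurent x g * laurent x h := by
  simp only [laurent, Pi.add_apply, ← Finset.prod_mul_distrib]
  exact Finset.prod_congr rfl fun j _ => zpow_add₀ (hx j) _ _

theorem laurent_zero (x : Fin n → F) : laurent x 0 = 1 := by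
  simp [laurent]

theorem laurent_neg (x : Fin n → F) (g : Fin n → ℤ) : laurent x (-g) = (laurent x g)⁻¹ := by
  simp [laurent]

theorem laurent_ne_zero {x : Fin n → F} (hx : ∀ i, x i ≠ 0) (g : Fin n → ℤ) :
    laurent x g ≠ 0 :=
  Finset.prod_ne_zero_iff.2 fun j _ => zpow_ne_zero _ (hx j)

theorem laurent_sum {x : Fin n → F} (hx : ∀ i, x i ≠ 0) {ι : Type*} (s : Finset ι)
    (g : ι → Fin n → ℤ) : laurent x (∑ k ∈ s, g k) = ∏ k ∈ s, laurent x (g k) := by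
  classical
  induction s using Finset.induction_on with
  | empty => simp [laurent_zero]
  | insert k s hk ih => rw [Finset.sum_insert hk, Finset.prod_insert hk, laurent_add hx, ih]

/-- `μ` is a Laurent monomial in `x`. -/
def IsLaurent (x : Fin n → F) (μ : F) : Prop := ∃ g, μ = laurent x g

theorem IsLaurent.one (x : Fin n → F) : IsLaurent x 1 := ⟨0, (laurent_zero x).symm⟩

theorem IsLaurent.mul {x : Fin n → F} (hx : ∀ i, x i ≠ 0) {μ ν : F} (h : IsLaurent x μ)
    (h' : IsLaurent x ν) : IsLaurent x (μ * ν) := by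
  obtain ⟨g, rfl⟩ := h
  obtain ⟨g', rfl⟩ := h'
  exact ⟨g + g', (laurent_add hx g g').symm⟩

theorem IsLaurent.div {x : Fin n → F} (hx : ∀ i, x i ≠ 0) {μ ν : F} (h : IsLaurent x μ)
    (h' : IsLaurent x ν) : IsLaurent x (μ / ν) := by
  obtain ⟨g', rfl⟩ := h'
  rw [div_eq_mul_inv]
  exact h.mul hx ⟨-g', (laurent_neg x g').symm⟩

theorem IsLaurent.ne_zero {x : Fin n → F} (hx : ∀ i, x i ≠ 0) {μ : F} (h : IsLaurent x μ) :
    μ ≠ 0 := by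
  obtain ⟨g, rfl⟩ := h
  exact laurent_ne_zero hx g

/-- The sum of the squarefree monomials in the variables `ŷ k = ∏ j, x j ^ B j k` given by a
family of sets of indices. -/
def yhatSum (x : Fin n → F) (B : Matrix (Fin n) (Fin n) ℤ) (s : Finset (Finset (Fin n))) : F :=
  ∑ e ∈ s, ∏ k ∈ e, laurent x fun j => B j k

theorem yhatSum_image_insert (x : Fin n → F) (B : Matrix (Fin n) (Fin n) ℤ)
    {s : Finset (Finset (Fin n))} {k : Fin n} (hs : ∀ e ∈ s, k ∉ e) :
    yhatSum x B (s.image (insert k)) = laurent x (fun j => B j k) * yhatSum x B s := by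
  unfold yhatSum
  rw [Finset.sum_image, Finset.mul_sum]
  · exact Finset.sum_congr rfl fun e he => Finset.prod_insert (hs e he)
  · intro e he e' he' h
    rw [← Finset.erase_insert (hs e he), h, Finset.erase_insert (hs e' he')]

/-- Only the second family uses `k`, so the union is disjoint and all multiplicities stay equal to
`1`. -/
theorem yhatSum_union_image_insert (x : Fin n → F) (B : Matrix (Fin n) (Fin n) ℤ)
    {s t : Finset (Finset (Fin n))} {k : Fin n} (hs : ∀ e ∈ s, k ∉ e) (ht : ∀ e ∈ t, k ∉ e) :
    yhatSum x B (s ∪ t.image (insert k)) =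
      yhatSum x B s + laurent x (fun j => B j k) * yhatSum x B t := by
  rw [← yhatSum_image_insert x B ht]
  unfold yhatSum
  refine Finset.sum_union (Finset.disjoint_left.2 fun e he he' => ?_)
  obtain ⟨e', -, rfl⟩ := Finset.mem_image.1 he'
  exact hs _ he (Finset.mem_insert_self k _)

/-- `y` is the product of a Laurent monomial and a multilinear polynomial in the `ŷ k` all of
whose coefficients are `0` or `1`. -/
def Expands (x : Fin n → F) (B : Matrix (Fin n) (Fin n) ℤ) (y : F) : Prop :=
  ∃ μ s, IsLaurent x μ ∧ y = μ * yhatSum x B s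

theorem IsLaurent.expands {x : Fin n → F} {B : Matrix (Fin n) (Fin n) ℤ} {μ : F}
    (h : IsLaurent x μ) : Expands x B μ :=
  ⟨μ, {∅}, h, by simp [yhatSum]⟩

end Laurent

/-! ### Expansion of a chord in a triangulation -/

section Expansion

variable {n : ℕ} {F : Type*} [Field F] {l : ℕ → ℕ → F} {S : SeedData n F} {D : Fin n → Sym2 ℕ}

theorem Realizes.isLaurent_edge (hS : Realizes l S D) (hl : IsPtolemy n l)
    {a b : ℕ} (h : IsEdge D a b) : IsLaurent S.x (l a b) :=
  ⟨fun j => ind D a b j, by simp [laurent, ← hS.prod_edge hl h]⟩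

/-- The cross-ratio of the quadrilateral around `D k` is `ŷ k`. -/
theorem Realizes.yhat_eq (hS : Realizes l S D) (hl : IsPtolemy n l) (hx : ∀ i, S.x i ≠ 0)
    {k : Fin n} {a b c d : ℕ} (hk : D k = s(a, b)) (hc : Cyc a c b) (hd : Cyc b d a)
    (hac : IsEdge D a c) (hcb : IsEdge D c b) (hbd : IsEdge D b d) (hda : IsEdge D d a) :
    l a c * l b d = laurent S.x (fun j => S.B j k) * (l c b * l d a) := by
  rw [← hS.prod_edge hl hac, ← hS.prod_edge hl hbd, ← hS.prod_edge hl hcb,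
    ← hS.prod_edge hl hda, laurent, ← Finset.prod_mul_distrib, ← Finset.prod_mul_distrib,
    ← Finset.prod_mul_distrib]
  refine Finset.prod_congr rfl fun j _ => ?_
  rw [hS.column_eq hk hc hd hac hcb hbd hda j]
  simp only [← zpow_natCast, ← zpow_add₀ (hx j)]
  congr 1
  ring

/-- The number of sides from `a` to `b` along the polygon. -/
def arcLength (n a b : ℕ) : ℕ := if a < b then b - a else b + (n + 3) - a

/-- The vertex `u` lies on the closed arc from `a` to `b`. -/
def OnArc (a b u : ℕ) : Prop := u = a ∨ u = b ∨ Cyc a u b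

/-- The walk from `p` to `q` has reached `ab`, with the triangle `abd` behind it and `q` ahead. The
values `l p a` and `l p b` share the monomial `μ` up to the factors `l a d` and `l b d`. The Ptolemy
relation for `p` and the next triangle `abc` turns the sums of `s` and `t` into the first plus `ŷ k`
times the second. The last hypothesis says that the labels used so far belong to diagonals not
contained in the arc ahead, so `k` is new. The arc shrinks at each step. -/
theorem Realizes.expands_of_crossing (hS : Realizes l S D) (hl : IsPtolemy n l)
    (hx : ∀ i, S.x i ≠ 0) {p q : ℕ} (hq : q < n + 3) (m : ℕ) :
    ∀ (a b d : ℕ) (k : Fin n) (s t : Finset (Finset (Fin n))) (μ : F), arcLength n a b ≤ m →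
      D k = s(a, b) → Cyc a q b → (p = a ∨ Cyc b p a) → Cyc b d a → IsEdge D b d →
      IsEdge D d a → IsLaurent S.x μ → l p a = μ * l a d * yhatSum S.x S.B s →
      l p b = μ * l b d * yhatSum S.x S.B t →
      (∀ e ∈ s ∪ t, ∀ j ∈ e, ∃ u ∈ D j, ¬ OnArc a b u) → Expands S.x S.B (l p q) := by
  induction m with
  | zero =>
    intro a b d k s t μ hm hk
    have := hS.triang.lt hk
    have := (hS.triang.not_side hk).1
    unfold arcLength at hm
    split_ifs at hm <;> omega
  | succ m ih =>
    intro a b d k s t μ hm hk haqb hp hd hbd hda hμ hpa hpb hst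
    have hD := hS.triang
    have hab : IsEdge D a b := Or.inr ⟨k, hk⟩
    obtain ⟨c, hc, hac, hcb⟩ := hD.exists_apex hab haqb hq
    have ha := hD.edge_lt hac
    have hb := (hD.edge_lt hab).2
    have hy := hS.yhat_eq hl hx hk hc hd hac hcb hbd hda
    have hmono := fun {u v} (h : IsEdge D u v) => hS.isLaurent_edge hl h
    have hne := fun {u v} (h : IsEdge D u v) => (hmono h).ne_zero hx
    have h1 := hne hab
    have h2 := hne hac
    have h3 := hne hcb
    have hk' : ∀ e ∈ s ∪ t, k ∉ e := by
      intro e he hke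
      obtain ⟨u, hu, hu'⟩ := hst e he k hke
      rw [hk, Sym2.mem_iff] at hu
      unfold OnArc at hu'
      tauto
    have hks : ∀ e ∈ s, k ∉ e := fun e he => hk' e (Finset.mem_union_left _ he)
    have hkt : ∀ e ∈ t, k ∉ e := fun e he => hk' e (Finset.mem_union_right _ he)
    have hpt : l a b * l p c = l a c * l p b + l c b * l p a := by
      rcases hp with rfl | hp
      · rw [hl.self, hl.symm p c]; ring
      · rw [hl.symm p c, hl.symm p b]; exact hl.ptolemy hc hp
    have hpc : l p c = μ * l d a * l c b / l a b *
        yhatSum S.x S.B (s ∪ t.image (insert k)) := by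
      rw [yhatSum_union_image_insert _ _ hks hkt]
      rw [div_mul_eq_mul_div, eq_div_iff h1, mul_comm, hpt, hpa, hpb, hl.symm a d]
      linear_combination μ * yhatSum S.x S.B t * hy
    have hsets : ∀ a' b' v, (∀ u, ¬ OnArc a b u → ¬ OnArc a' b' u) → v ∈ D k →
        ¬ OnArc a' b' v → ∀ e ∈ s ∪ t ∪ t.image (insert k), ∀ j ∈ e, ∃ u ∈ D j,
          ¬ OnArc a' b' u := by
      intro a' b' v h hv hv' e he j hj
      have hold : ∀ e ∈ s ∪ t, ∀ j ∈ e, ∃ u ∈ D j, ¬ OnArc a' b' u := by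
        intro e he j hj
        obtain ⟨u, hu, hu'⟩ := hst e he j hj
        exact ⟨u, hu, h u hu'⟩
      rcases Finset.mem_union.1 he with he | he
      · exact hold e he j hj
      · obtain ⟨e', he', rfl⟩ := Finset.mem_image.1 he
        rcases Finset.mem_insert.1 hj with rfl | hj
        · exact ⟨v, hv, hv'⟩
        · exact hold e' (Finset.mem_union_right _ he') j hj
    -- Either `q` is the new apex and the walk ends, or it continues through `ac` or `cb`, with the
    -- remaining corner of `abc` as the new `d`.
    have hcase : q = c ∨ Cyc a q c ∨ Cyc c q b := by
      clear hp hst hsets; unfold Cyc at *; omega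
    rcases hcase with rfl | hq' | hq'
    · exact ⟨_, _, ((hμ.mul hx (hmono hda)).mul hx (hmono hcb)).div hx (hmono hab), hpc⟩
    · obtain ⟨k', hk''⟩ : ∃ k', D k' = s(a, c) := by
        refine hac.resolve_left fun h => ?_
        clear hp hst hsets; unfold Side Cyc at *; omega
      refine ih a c b k' s (s ∪ t.image (insert k)) (μ * l d a / l a b) ?_ hk'' hq' ?_ ?_ hcb
        hab.symm ((hμ.mul hx (hmono hda)).div hx (hmono hab)) ?_ ?_ ?_
      · unfold arcLength at *; clear hp hst hsets; unfold Cyc at *; split_ifs at * <;> omega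
      · rcases hp with hp | hp
        · exact Or.inl hp
        · right; clear hst hsets; unfold Cyc at *; omega
      · exact hc.rotate
      · rw [hpa, div_mul_cancel₀ _ h1, hl.symm a d]
      · rw [hpc]; ring
      · intro e he
        refine hsets a c b ?_ ?_ ?_ e ?_
        · unfold OnArc; clear hp hst hsets; unfold Cyc at *; omega
        · rw [hk]; simp
        · unfold OnArc; clear hp hst hsets; unfold Cyc at *; omega
        · simp only [Finset.mem_union] at he ⊢; tauto
    · obtain ⟨k', hk''⟩ : ∃ k', D k' = s(c, b) := by
        refine hcb.resolve_left fun h => ?_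
        clear hp hst hsets; unfold Side Cyc at *; omega
      refine ih c b a k' (s ∪ t.image (insert k)) (t.image (insert k))
        (μ * l d a * l c b / l a b / l a c) ?_ hk'' hq' ?_ ?_ hab.symm hac
        ((((hμ.mul hx (hmono hda)).mul hx (hmono hcb)).div hx (hmono hab)).div hx (hmono hac))
        ?_ ?_ ?_
      · unfold arcLength at *; clear hp hst hsets; unfold Cyc at *; split_ifs at * <;> omega
      · right
        rcases hp with rfl | hp
        · exact hc.rotate.rotate
        · clear hst hsets; unfold Cyc at *; omega
      · exact hc.rotate.rotate
      · rw [hpc, hl.symm c a, div_mul_cancel₀ _ h2]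
      -- The old sum for `b` acquires a factor `ŷ k`, which compensates for the change of `μ`.
      · rw [hpb, yhatSum_image_insert _ _ hkt, hl.symm b a]
        field_simp
        linear_combination μ * yhatSum S.x S.B t * hy
      · intro e he
        refine hsets c b a ?_ ?_ ?_ e ?_
        · unfold OnArc; clear hp hst hsets; unfold Cyc at *; omega
        · rw [hk]; simp
        · unfold OnArc; clear hp hst hsets; unfold Cyc at *; omega
        · simp only [Finset.mem_union] at he ⊢; tauto

/-- The expansion of an arbitrary chord in the cluster of a triangulation. -/
theorem Realizes.expands (hS : Realizes l S D) (hl : IsPtolemy n l)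
    (hx : ∀ i, S.x i ≠ 0) {p q : ℕ} (hp : p < n + 3) (hq : q < n + 3) (hpq : p ≠ q) :
    Expands S.x S.B (l p q) := by
  have hD := hS.triang
  -- `b` is the vertex preceding `p`, so every other vertex lies on the arc from `p` to `b`.
  obtain ⟨b, hb⟩ : ∃ b, b < n + 3 ∧ (p = b + 1 ∨ p = 0 ∧ b = n + 2) := by
    rcases p with _ | p
    · exact ⟨n + 2, by omega, by omega⟩
    · exact ⟨p, by omega, by omega⟩
  have hside : IsEdge D p b := Or.inl (by unfold Side; omega)
  have hmono := fun {u v} (h : IsEdge D u v) => hS.isLaurent_edge hl h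
  by_cases hqb : q = b
  · subst hqb
    exact (hmono hside).expands
  have hpqb : Cyc p q b := by unfold Cyc; omega
  obtain ⟨c, hc, hpc, hcb⟩ := hD.exists_apex hside hpqb hq
  have hcn := (hD.edge_lt hpc).2
  have hcase : q = c ∨ Cyc p q c ∨ Cyc c q b := by unfold Cyc at *; omega
  rcases hcase with rfl | hq' | hq'
  · exact (hmono hpc).expands
  · obtain ⟨k, hk⟩ : ∃ k, D k = s(p, c) := by
      refine hpc.resolve_left fun h => ?_
      unfold Side Cyc at *; omega
    -- Here `a = p`: the empty family represents `l p p = 0`, and `μ` is chosen to make the sum at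
    -- `c` equal to `1`.
    refine hS.expands_of_crossing hl hx hq _ p c b k ∅ {∅} (l p c / l c b) le_rfl hk hq'
      (Or.inl rfl) hc.rotate hcb hside.symm ((hmono hpc).div hx (hmono hcb)) ?_ ?_ ?_
    · simp [hl.self, yhatSum]
    · rw [div_mul_cancel₀ _ ((hmono hcb).ne_zero hx)]
      simp [yhatSum]
    · simp
  · obtain ⟨k, hk⟩ : ∃ k, D k = s(c, b) := by
      refine hcb.resolve_left fun h => ?_
      unfold Side Cyc at *; omega
    refine hS.expands_of_crossing hl hx hq _ c b p k {∅} {∅} 1 le_rfl hk hq'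
      (Or.inr hc.rotate.rotate) hc.rotate.rotate hside.symm hpc (IsLaurent.one _) ?_ ?_ ?_
    · simp [yhatSum, hl.symm p c]
    · simp [yhatSum, hl.symm p b]
    · simp

end Expansion

/-! ### Reduced Laurent expressions -/

section Reduced

variable {n : ℕ} {F : Type*} [Field F]

theorem aeval_monomial_eq_laurent (x : Fin n → F) (m : Fin n →₀ ℕ) :
    MvPolynomial.aeval x (MvPolynomial.monomial m (1 : ℤ)) = laurent x fun j => (m j : ℤ) := by
  rw [MvPolynomial.aeval_monomial, map_one, one_mul, Finsupp.prod_fintype _ _ (by simp)]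
  simp [laurent]

variable [CharZero F] {x : Fin n → F}

theorem aeval_int_injective (hx : AlgebraicIndependent ℚ x) :
    Function.Injective (MvPolynomial.aeval x : MvPolynomial (Fin n) ℤ →ₐ[ℤ] F) :=
  algebraicIndependent_iff_injective_aeval.1
    (hx.restrictScalars (R := ℤ) (algebraMap ℤ ℚ).injective_int)

/-- Multiplying the numerators by the monomials `u` and `v` brings both fractions to the denominator
with exponents `max (d i) (d' i)`. If `d j < d' j`, the prime `X j` divides `u` but not `v`, hence
divides `N'`. -/
theorem IsReducedLaurentExpr.le (hx : AlgebraicIndependent ℚ x) {y : F}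
    {N N' : MvPolynomial (Fin n) ℤ} {d d' : Fin n → ℤ} (h : IsReducedLaurentExpr x y N d)
    (h' : IsReducedLaurentExpr x y N' d') (j : Fin n) : d' j ≤ d j := by
  by_contra! hlt
  have hx0 : ∀ i, x i ≠ 0 := fun i => hx.ne_zero i
  let u : Fin n →₀ ℕ := Finsupp.equivFunOnFinite.symm fun i => (d' i - d i).toNat
  let v : Fin n →₀ ℕ := Finsupp.equivFunOnFinite.symm fun i => (d i - d' i).toNat
  have huv : (fun i => (u i : ℤ)) + d = (fun i => (v i : ℤ)) + d' := by
    funext i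
    simp only [u, v, Pi.add_apply, Finsupp.equivFunOnFinite_symm_apply_apply]
    omega
  have heq : N * MvPolynomial.monomial u 1 = N' * MvPolynomial.monomial v 1 := by
    apply aeval_int_injective hx
    rw [map_mul, map_mul, aeval_monomial_eq_laurent, aeval_monomial_eq_laurent]
    have h1 : MvPolynomial.aeval x N = y * laurent x d := by
      rw [h.2, laurent, div_mul_cancel₀]
      exact laurent_ne_zero hx0 d
    have h2 : MvPolynomial.aeval x N' = y * laurent x d' := by
      rw [h'.2, laurent, div_mul_cancel₀]
      exact laurent_ne_zero hx0 d'
    rw [h1, h2, mul_assoc, mul_assoc, ← laurent_add hx0, ← laurent_add hx0, add_comm d,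
      add_comm d', huv]
  have hdvd : MvPolynomial.X j ∣ N' * MvPolynomial.monomial v 1 := by
    rw [← heq]
    refine Dvd.dvd.mul_left (MvPolynomial.X_dvd_monomial.2 (Or.inr ?_)) N
    simp only [u, Finsupp.equivFunOnFinite_symm_apply_apply]
    omega
  rcases MvPolynomial.X_dvd_mul_iff.1 hdvd with h1 | h1
  · exact h'.1 j h1
  · rcases MvPolynomial.X_dvd_monomial.1 h1 with h1 | h1
    · exact one_ne_zero h1
    · simp only [v, Finsupp.equivFunOnFinite_symm_apply_apply] at h1
      omega

theorem IsReducedLaurentExpr.unique (hx : AlgebraicIndependent ℚ x) {y : F}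
    {N N' : MvPolynomial (Fin n) ℤ} {d d' : Fin n → ℤ} (h : IsReducedLaurentExpr x y N d)
    (h' : IsReducedLaurentExpr x y N' d') : N = N' ∧ d = d' := by
  have hd : d = d' := funext fun j => le_antisymm (h'.le hx h j) (h.le hx h' j)
  subst hd
  refine ⟨aeval_int_injective hx ?_, rfl⟩
  have h2 := h.2.symm.trans h'.2
  exact (div_left_inj' (laurent_ne_zero (fun i => hx.ne_zero i) d)).1 h2

/-- A nonempty sum of Laurent monomials has a reduced expression whose coefficients count
coinciding exponent vectors. -/
theorem exists_isReducedLaurentExpr (hx : AlgebraicIndependent ℚ x) {ι : Type*} {s : Finset ι}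
    (hs : s.Nonempty) (h : ι → Fin n → ℤ) :
    ∃ N d, IsReducedLaurentExpr x (∑ e ∈ s, laurent x (h e)) N d ∧
      ∀ m, ∃ g, N.coeff m = #{e ∈ s | h e = g} := by
  classical
  have hx0 : ∀ i, x i ≠ 0 := fun i => hx.ne_zero i
  -- The largest monomial that can be extracted has the coordinatewise minima as exponents.
  let δ : Fin n → ℤ := fun j => s.inf' hs fun e => h e j
  have hδ : ∀ e ∈ s, ∀ j, δ j ≤ h e j := fun e he j => Finset.inf'_le (fun e => h e j) he
  let u : ι → Fin n →₀ ℕ := fun e => Finsupp.equivFunOnFinite.symm fun j => (h e j - δ j).toNat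
  have hu : ∀ e ∈ s, ∀ j, (u e j : ℤ) = h e j - δ j := by
    intro e he j
    have := hδ e he j
    simp only [u, Finsupp.equivFunOnFinite_symm_apply_apply]
    omega
  let N : MvPolynomial (Fin n) ℤ := ∑ e ∈ s, MvPolynomial.monomial (u e) 1
  have hN : ∀ m, N.coeff m = #{e ∈ s | u e = m} := by
    intro m
    simp only [N, MvPolynomial.coeff_sum, MvPolynomial.coeff_monomial]
    rw [Finset.sum_boole]
  refine ⟨N, -δ, ⟨?_, ?_⟩, ?_⟩
  · rintro j ⟨q, hq⟩
    -- A term attaining the minimum in coordinate `j` is free of `X j`, and it cannot cancel because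
    -- coefficients are cardinalities.
    obtain ⟨e, he, hej⟩ := Finset.exists_mem_eq_inf' hs fun e => h e j
    have h0 : u e j = 0 := by
      have := hu e he j
      have : δ j = h e j := hej
      omega
    have h1 := hN (u e)
    rw [hq, MvPolynomial.coeff_X_mul', if_neg (by simp [h0])] at h1
    have h2 : 0 < #{e' ∈ s | u e' = u e} :=
      Finset.card_pos.2 ⟨e, Finset.mem_filter.2 ⟨he, rfl⟩⟩
    omega
  · refine (eq_div_iff (laurent_ne_zero hx0 (-δ))).2 ?_
    simp only [N, map_sum]
    rw [Finset.sum_mul]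
    refine Finset.sum_congr rfl fun e he => ?_
    rw [aeval_monomial_eq_laurent, ← laurent_add hx0]
    congr 1
    funext j
    rw [hu e he j]
    simp [sub_eq_add_neg]
  · intro m
    refine ⟨fun j => m j + δ j, ?_⟩
    rw [hN]
    congr 2
    refine Finset.filter_congr fun e he => ?_
    constructor
    · rintro rfl
      funext j
      rw [hu e he j]
      ring
    · intro h'
      ext j
      have h1 := congrFun h' j
      have h2 := hu e he j
      omega

end Reduced

/-! ### Coinciding exponent vectors -/

section Fibres

variable {n : ℕ}

/-- A line contains at most two vertices of the cube. -/
theorem KernelRankLEOne.card_fibre_le {B : Matrix (Fin n) (Fin n) ℤ} (hB : KernelRankLEOne B)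
    (s : Finset (Finset (Fin n))) (g₀ g : Fin n → ℤ) :
    #{e ∈ s | g₀ + ∑ k ∈ e, (fun j => B j k) = g} ≤ 2 := by
  classical
  by_contra! hlt
  obtain ⟨e₁, h₁, e₂, h₂, e₃, h₃, h12, h13, h23⟩ := Finset.two_lt_card.1 hlt
  simp only [Finset.mem_filter] at h₁ h₂ h₃
  let χ : Finset (Fin n) → Fin n → ℤ := fun e k => if k ∈ e then 1 else 0
  have hχ : ∀ e i, ∑ j, B i j * χ e j = (∑ k ∈ e, (fun j => B j k)) i := by
    intro e i
    simp [χ, Finset.sum_apply]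
  have hker : ∀ e e', g₀ + ∑ k ∈ e, (fun j => B j k) = g →
      g₀ + ∑ k ∈ e', (fun j => B j k) = g → ∀ i, ∑ j, B i j * (χ e j - χ e' j) = 0 := by
    intro e e' h h' i
    simp only [mul_sub, Finset.sum_sub_distrib, hχ]
    rw [add_left_cancel (h.trans h'.symm), sub_self]
  have hχinj : ∀ e e', (∀ k, χ e k = χ e' k) → e = e' := by
    intro e e' h
    ext k
    have := h k
    simp only [χ] at this
    split_ifs at this <;> simp_all
  have h01 : ∀ e k, χ e k = 0 ∨ χ e k = 1 := by
    intro e k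
    simp only [χ]
    split_ifs <;> simp
  -- Three points of a fibre give two kernel vectors, hence three collinear vertices of the cube.
  obtain ⟨α, β, hαβ, h0⟩ := hB _ _ (hker _ _ h₁.2 h₂.2) (hker _ _ h₁.2 h₃.2)
  by_cases hα : α = 0
  · refine h13 (hχinj _ _ fun k => ?_)
    have := h0 k
    rw [hα, zero_mul, zero_add] at this
    have := (mul_eq_zero.1 this).resolve_left (hαβ.resolve_left (not_not.2 hα))
    omega
  by_cases hβ : β = 0
  · refine h12 (hχinj _ _ fun k => ?_)
    have := h0 k
    rw [hβ, zero_mul, add_zero] at this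
    have := (mul_eq_zero.1 this).resolve_left hα
    omega
  by_cases hs : α + β = 0
  · refine h23 (hχinj _ _ fun k => ?_)
    have h1 : α * (χ e₃ k - χ e₂ k) = 0 := by
      linear_combination h0 k - (χ e₁ k - χ e₃ k) * hs
    have := (mul_eq_zero.1 h1).resolve_left hα
    omega
  -- Now `χ e₁` is an affine combination of `χ e₂` and `χ e₃` with both weights nonzero; in a
  -- coordinate where these two differ, its value would be neither `0` nor `1`.
  · refine h12 (hχinj _ _ fun k => ?_)
    have := h0 k
    rcases h01 e₁ k with h1 | h1 <;> rcases h01 e₂ k with h2 | h2 <;>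
      rcases h01 e₃ k with h3 | h3 <;> rw [h1, h2, h3] at this <;> omega

end Fibres

/-! ### Propagation along the cluster pattern and conclusion -/

section Pattern

/-- A property of vertices of the regular tree that is stable under passing to neighbours and holds
at some vertex holds at all vertices. -/
theorem RegularTree.induction {n : ℕ} {p : RegularTree n → Prop} {t : RegularTree n} (ht : p t)
    (h : ∀ k t t', Edge k t t' → p t → p t') (t' : RegularTree n) : p t' := by
  have symm : ∀ {k : Fin n} {t t' : RegularTree n}, Edge k t t' → Edge k t' t := fun h => h.symm
  have root : ∀ w (hw : w.IsChain (fun a b => a ≠ b)),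
      p ⟨w, hw⟩ ↔ p ⟨[], List.isChain_nil⟩ := by
    intro w
    induction w with
    | nil => exact fun _ => Iff.rfl
    | cons k w ih =>
      intro hw
      rw [← ih hw.tail]
      have he : Edge k (⟨w, hw.tail⟩ : RegularTree n) ⟨k :: w, hw⟩ := Or.inl rfl
      exact ⟨h k _ _ (symm he), h k _ _ he⟩
  exact (root t'.1 t'.2).2 ((root t.1 t.2).1 ht)

variable {n : ℕ} {F : Type*} [Field F] [CharZero F] {P : ClusterPattern n F}

theorem ClusterPattern.x_ne_zero (P : ClusterPattern n F) (t : RegularTree n) (i : Fin n) :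
    (P.seed t).x i ≠ 0 :=
  (P.isSeed t).algebraicIndependent.ne_zero i

/-- All seeds of a cluster pattern of type `A` are realized by triangulations, with a common
Ptolemy function, and have exchange matrices of corank at most one. -/
theorem ClusterPattern.IsTypeA.exists_realizes (hA : P.IsTypeA) (hn : 0 < n) :
    ∃ l, IsPtolemy n l ∧ ∀ t, (∃ D, Realizes l (P.seed t) D) ∧ KernelRankLEOne (P.seed t).B := by
  obtain ⟨t, σ, hσ⟩ := hA
  obtain ⟨ε, hε⟩ := exists_isPath (P.isSeed t).skewSymmetrizable hσ
  obtain ⟨t, ε, hε, h1⟩ := exists_path_orient (fun t => (P.seed t).B)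
    (fun t k => by
      obtain ⟨t', ht', -⟩ := existsUnique_edge k t
      exact ⟨t', by rw [P.seed_eq_mutate k t t' ht']; rfl⟩) σ t ε hε n le_rfl
  have hl := isPtolemy_fanPtolemy (n := n) (x := (P.seed t).x ∘ σ) fun i => P.x_ne_zero t (σ i)
  refine ⟨_, hl, RegularTree.induction (t := t)
    ⟨⟨_, realizes_fan hε fun i hi => h1 i (by omega)⟩, hε.kernelRankLEOne hn⟩ ?_⟩
  rintro k t t' he ⟨⟨D, hD⟩, hK⟩
  have hseed := P.seed_eq_mutate k t t' he
  obtain ⟨D', hD'⟩ := hD.mutate hl (P.x_ne_zero t) k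
  rw [← hseed] at hD'
  refine ⟨⟨D', hD'⟩, KernelRankLEOne.of_mutate (k := k) ?_ ?_⟩
  · have := hD'.skew k k
    omega
  -- The edge is read backwards: the old matrix is the mutation of the new one, so the kernel bound
  -- passes to the new one.
  · have := congrArg SeedData.B (P.seed_eq_mutate k t' t he.symm)
    exact (show (P.seed t).B = mutateMatrix k (P.seed t').B from this) ▸ hK

end Pattern

end ClusterA

theorem proposition3p5 {n : ℕ} {F : Type*} [Field F] [CharZero F]
    (P : ClusterA.ClusterPattern n F) (hA : P.IsTypeA)
    (t₀ t : ClusterA.RegularTree n) (i : Fin n) :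
    (∃! p : MvPolynomial (Fin n) ℤ × (Fin n → ℤ),
      ClusterA.IsReducedLaurentExpr (P.seed t₀).x ((P.seed t).x i) p.1 p.2) ∧
    ∀ (N : MvPolynomial (Fin n) ℤ) (d : Fin n → ℤ),
      ClusterA.IsReducedLaurentExpr (P.seed t₀).x ((P.seed t).x i) N d →
      ∀ m : Fin n →₀ ℕ, N.coeff m = 0 ∨ N.coeff m = 1 ∨ N.coeff m = 2 := by
  obtain ⟨l, hl, h⟩ := hA.exists_realizes i.pos
  obtain ⟨⟨D, hD⟩, hK⟩ := h t₀
  obtain ⟨⟨D', hD'⟩, -⟩ := h t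
  have hx := (P.isSeed t₀).algebraicIndependent
  have hx0 := P.x_ne_zero t₀
  obtain ⟨p, q, -, -, hpq, -⟩ := hD'.column i
  have hexp := hD.expands hl hx0 (hD'.triang.lt hpq) (hD'.triang.lt' hpq)
    (hD'.triang.not_side hpq).1
  rw [← hD'.x_eq hpq] at hexp
  obtain ⟨μ, s, ⟨g, rfl⟩, hy⟩ := hexp
  have hy' : (P.seed t).x i =
      ∑ e ∈ s, ClusterA.laurent (P.seed t₀).x (g + ∑ k ∈ e, fun j => (P.seed t₀).B j k) := by
    rw [hy, ClusterA.yhatSum, Finset.mul_sum]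
    refine Finset.sum_congr rfl fun e _ => ?_
    rw [ClusterA.laurent_add hx0, ClusterA.laurent_sum hx0]
  -- An empty sum would make the cluster variable zero.
  have hs : s.Nonempty := by
    rw [Finset.nonempty_iff_ne_empty]
    rintro rfl
    exact P.x_ne_zero t i (by rw [hy', Finset.sum_empty])
  obtain ⟨N, d, hN, hcoeff⟩ := ClusterA.exists_isReducedLaurentExpr hx hs
    fun e => g + ∑ k ∈ e, fun j => (P.seed t₀).B j k
  rw [← hy'] at hN
  refine ⟨⟨(N, d), hN, ?_⟩, ?_⟩
  · rintro ⟨N', d'⟩ h'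
    have := ClusterA.IsReducedLaurentExpr.unique hx h' hN
    exact Prod.ext this.1 this.2
  · intro N' d' h' m
    rw [(ClusterA.IsReducedLaurentExpr.unique hx h' hN).1]
    obtain ⟨g', h0⟩ := hcoeff m
    have := hK.card_fibre_le s g g'
    rw [h0]
    omega
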